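/- Let $n\ge 1$ be an integer and let $\boldsymbol W=(\boldsymbol W_t)_{t\ge 0}$, $\boldsymbol W_t=(W^{(1)}_t,\dots,W^{(n)}_t)$, be Brownian motion in $\mathbb R^n$ starting at the origin, that is, the coordinates $W^{(1)},\dots,W^{(n)}$ are independent standard one-dimensional Brownian motions. Let $\mathcal H_1=\operatorname{conv}\{\boldsymbol W_s:0\le s\le 1\}$ be the convex hull of the path up to time $1$, and let $D_1$ be the Euclidean diameter of $\mathcal H_1$. Then $D_1$ is integrable and \[ \sqrt{n}\;\le\;\mathbb E[D_1]\;\le\;2\sqrt{\log 2}\,\sqrt{n}. \] -/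

import Mathlib

open MeasureTheory ProbabilityTheory
open scoped NNReal

/-- Brownian motion in `ℝⁿ` starting at the origin: each coordinate process is a standard real
Brownian motion (Gaussian finite-dimensional laws with covariance `min s t`, hence almost surely
`0` at time `0`, and almost surely continuous paths), and the coordinate processes are
mutually independent, as random elements of the path space `ℝ≥0 → ℝ`. -/
structure IsBrownianMotion {Ω : Type*} [MeasurableSpace Ω] {n : ℕ}
    (W : ℝ≥0 → Ω → EuclideanSpace ℝ (Fin n)) (P : Measure Ω) : Prop where
  isBrownianReal_coord : ∀ j : Fin n, IsBrownianReal (fun t ω ↦ W t ω j) P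
  iIndepFun_coord : iIndepFun (fun (j : Fin n) (ω : Ω) (t : ℝ≥0) ↦ W t ω j) P

/-- The convex hull of the path of `W` run up to time `t`. -/
def pathHull {Ω : Type*} {n : ℕ} (W : ℝ≥0 → Ω → EuclideanSpace ℝ (Fin n)) (t : ℝ≥0) (ω : Ω) :
    Set (EuclideanSpace ℝ (Fin n)) :=
  convexHull ℝ ((fun s ↦ W s ω) '' Set.Icc 0 t)

/-- The diameter process: the Euclidean diameter of the convex hull of the path up to time `t`.
On the event that the path is continuous, the hull is compact, so its diameter is finite. -/
noncomputable def hullDiam {Ω : Type*} {n : ℕ} (W : ℝ≥0 → Ω → EuclideanSpace ℝ (Fin n))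
    (t : ℝ≥0) (ω : Ω) : ℝ :=
  Metric.diam (pathHull W t ω)

-- The diameter of the hull is the diameter of the path; two martingale arguments, run on Gaussian
-- walks instead of in continuous time, give the two bounds.
--
-- Upper bound. The squared diameter is at most the sum of the squared ranges of the coordinates, so
-- by `(E D)² ≤ E D²` it suffices that a real Brownian motion has mean square range at most `4 log
-- 2` at time `1`. Let `a` be the height of a walk above its running minimum, `b` its depth below
-- its running maximum, `R = a + b`, and `g` the function `rangeKernel`. While the range is
-- constant, a step `x` turns `a - b` into `a - b + 2x`, and for `x` of law `N(0, s²)` the mean of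
-- `cosh (a - b + 2x)` is `exp (2s²) cosh (a - b)`. The equation `g' = -2r / cosh² r` is what makes
-- `g(R) cosh R cosh (a - b)` pay for the growth of `R²` when the range increases (`range_step`).
-- Hence the expected increments of `R²`, discounted by `exp (-2s²)` per step, sum to at most `g(0)
-- = 2 log 2`. Brownian scaling and subsampling make the mean square range superadditive, and an
-- Abelian argument turns the discounted bound into `4 log 2` per unit of time. Fatou's lemma passes
-- from grids to the path.
--
-- Lower bound. `D` dominates the norm of the path on `[0, 1]`. Since `|W_t|² - n t` is a
-- martingale, the mean exit time from the ball of squared radius `ρ` is `ρ / n`; by scaling this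
-- amounts to `E[D⁻²] ≤ 1 / n`, and convexity of `D ↦ D⁻²` gives `E D ≥ √n`. For the walk, overshoot
-- on leaving the ball is controlled by fourth moments and vanishes in the limit.

-- The kernel and the one-step inequality for the range

/-- The function `r ↦ ∫_r^∞ 2 s / cosh² s ds`. -/
noncomputable def rangeKernel (r : ℝ) : ℝ :=
  2 * (Real.log 2 - r * (Real.sinh r / Real.cosh r) + Real.log (Real.cosh r))

theorem rangeKernel_zero : rangeKernel 0 = 2 * Real.log 2 := by
  simp [rangeKernel]

theorem hasDerivAt_rangeKernel (r : ℝ) :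
    HasDerivAt rangeKernel (-(2 * r) / Real.cosh r ^ 2) r := by
  have hc : Real.cosh r ≠ 0 := (Real.cosh_pos r).ne'
  have h1 := (Real.hasDerivAt_sinh r).div (Real.hasDerivAt_cosh r) hc
  have h2 := (hasDerivAt_id r).mul h1
  have h3 := (Real.hasDerivAt_cosh r).log hc
  have h4 := (((hasDerivAt_const r (Real.log 2)).sub h2).add h3).const_mul 2
  refine h4.congr_deriv ?_
  have := Real.cosh_sq r
  simp only [id, Pi.div_apply]
  field_simp
  linear_combination (-r) * this

theorem continuous_rangeKernel : Continuous rangeKernel :=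
  continuous_iff_continuousAt.2 fun r ↦ (hasDerivAt_rangeKernel r).continuousAt

theorem rangeKernel_nonneg {r : ℝ} (hr : 0 ≤ r) : 0 ≤ rangeKernel r := by
  have hc := Real.cosh_pos r
  have h1 : r ≤ Real.log 2 + Real.log (Real.cosh r) := by
    rw [← Real.log_mul two_ne_zero hc.ne', Real.le_log_iff_exp_le (by positivity), Real.cosh_eq]
    linarith [Real.exp_pos (-r)]
  have h2 : Real.sinh r / Real.cosh r ≤ 1 := by
    rw [div_le_one hc]; exact (Real.sinh_lt_cosh r).le
  have h3 := mul_le_mul_of_nonneg_left h2 hr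
  unfold rangeKernel
  linarith

/-- Linear growth of this product bounds the potential of a walk by its range, hence makes the
potential integrable. -/
theorem rangeKernel_mul_cosh_sq_le {r : ℝ} (hr : 0 ≤ r) :
    rangeKernel r * Real.cosh r ^ 2 ≤ 2 * (1 + r) := by
  have hc := Real.cosh_pos r
  have he := Real.exp_pos r
  have hm : Real.exp (-r) * Real.exp r = 1 := by rw [← Real.exp_add]; simp
  set e := Real.exp (-r) with he'
  have hepos : 0 < e := Real.exp_pos _
  have hcosh : Real.cosh r = (Real.exp r + e) / 2 := Real.cosh_eq r
  have he1 : e ≤ 1 := Real.exp_le_one_iff.2 (by linarith)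
  have hlog : Real.log 2 + Real.log (Real.cosh r) ≤ r + e ^ 2 := by
    rw [← Real.log_mul two_ne_zero hc.ne']
    have : 2 * Real.cosh r = Real.exp r * (1 + e ^ 2) := by
      rw [hcosh]; linear_combination (-e) * hm
    rw [this, Real.log_mul he.ne' (by positivity), Real.log_exp]
    linarith [Real.log_le_sub_one_of_pos (show 0 < 1 + e ^ 2 by positivity)]
  have hec : e * Real.cosh r ≤ 1 := by rw [hcosh]; nlinarith
  have hec0 : 0 ≤ e * Real.cosh r := by positivity
  have hs : Real.sinh r = Real.cosh r - e := by
    rw [Real.sinh_eq, Real.cosh_eq]; ring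
  have key : rangeKernel r * Real.cosh r ^ 2
      = 2 * ((Real.log 2 + Real.log (Real.cosh r) - r) * Real.cosh r ^ 2
        + r * (e * Real.cosh r)) := by
    unfold rangeKernel
    rw [hs]
    field_simp
    ring
  rw [key]
  have h1 : (Real.log 2 + Real.log (Real.cosh r) - r) * Real.cosh r ^ 2
      ≤ (e * Real.cosh r) ^ 2 := by
    rw [mul_pow]
    exact mul_le_mul_of_nonneg_right (by linarith) (by positivity)
  have h2 : (e * Real.cosh r) ^ 2 ≤ 1 := pow_le_one₀ hec0 hec
  have h3 := mul_le_mul_of_nonneg_left hec hr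
  linarith

/-- The right side is the integral of `2s cosh² R / cosh² s` over `[r, R]`, and there `cosh s ≤ cosh
R`. -/
theorem sq_sub_sq_le_rangeKernel_sub {r R : ℝ} (hr : 0 ≤ r) (hrR : r ≤ R) :
    R ^ 2 - r ^ 2 ≤ (rangeKernel r - rangeKernel R) * Real.cosh R ^ 2 := by
  have hd (s : ℝ) : HasDerivAt (fun s ↦ rangeKernel s + s ^ 2 / Real.cosh R ^ 2)
      (-(2 * s) / Real.cosh s ^ 2 + 2 * s / Real.cosh R ^ 2) s := by
    refine (hasDerivAt_rangeKernel s).add ?_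
    simpa using (hasDerivAt_pow 2 s).div_const (Real.cosh R ^ 2)
  have hanti : AntitoneOn (fun s ↦ rangeKernel s + s ^ 2 / Real.cosh R ^ 2) (Set.Icc 0 R) := by
    refine antitoneOn_of_deriv_nonpos (convex_Icc 0 R)
      (fun s _ ↦ (hd s).continuousAt.continuousWithinAt)
      (fun s _ ↦ (hd s).differentiableAt.differentiableWithinAt) fun s hs ↦ ?_
    rw [interior_Icc] at hs
    rw [(hd s).deriv]
    have h1 : Real.cosh s ≤ Real.cosh R := by
      rw [Real.cosh_le_cosh, abs_of_pos hs.1, abs_of_nonneg (hr.trans hrR)]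
      exact hs.2.le
    have h2 : 2 * s / Real.cosh R ^ 2 ≤ 2 * s / Real.cosh s ^ 2 := by
      have := Real.cosh_pos s
      have := hs.1
      gcongr
    rw [neg_div]
    linarith
  have h := hanti ⟨hr, hrR⟩ ⟨hr.trans hrR, le_rfl⟩ hrR
  simp only at h
  have hc : 0 < Real.cosh R ^ 2 := by have := Real.cosh_pos R; positivity
  have h' : (R ^ 2 - r ^ 2) / Real.cosh R ^ 2 ≤ rangeKernel r - rangeKernel R := by
    rw [sub_div]; linarith
  rwa [div_le_iff₀ hc] at h'

/-- A step that overshoots the old range `r` by `d` leaves the walk at an extreme point, so both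
hyperbolic cosines on the left have argument `r + d`. By `cosh r cosh (r + 2d) = cosh² (r + d) +
sinh² d`, the claim follows from the integral estimate for the kernel, with a nonnegative term to
spare. -/
theorem range_step_of_exceed {r d : ℝ} (hr : 0 ≤ r) (hd : 0 ≤ d) :
    (r + d) ^ 2 + rangeKernel (r + d) * Real.cosh (r + d) * Real.cosh (r + d)
      ≤ r ^ 2 + rangeKernel r * Real.cosh r * Real.cosh (r + 2 * d) := by
  have h1 := sq_sub_sq_le_rangeKernel_sub hr (le_add_of_nonneg_right hd)
  have h2 : Real.cosh r * Real.cosh (r + 2 * d)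
      = Real.cosh (r + d) ^ 2 + Real.sinh d ^ 2 := by
    have e1 : r = (r + d) - d := by ring
    have e2 : r + 2 * d = (r + d) + d := by ring
    rw [e2]
    nth_rewrite 1 [e1]
    rw [Real.cosh_sub (r + d) d, Real.cosh_add (r + d) d]
    linear_combination (Real.cosh (r + d) ^ 2 - 1) * Real.cosh_sq d
      - (Real.sinh d ^ 2) * (-(Real.cosh_sq (r + d))) + Real.cosh_sq d
  have h3 : 0 ≤ rangeKernel r * Real.sinh d ^ 2 :=
    mul_nonneg (rangeKernel_nonneg hr) (sq_nonneg _)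
  rw [mul_assoc (rangeKernel r), h2]
  linarith

/-- Equality holds when the step stays within the current range; a new maximum and a new minimum are
mirror images of the overshooting case. -/
theorem range_step {a b : ℝ} (ha : 0 ≤ a) (hb : 0 ≤ b) (x : ℝ) :
    (max (a + x) 0 + max (b - x) 0) ^ 2 + rangeKernel (max (a + x) 0 + max (b - x) 0)
        * Real.cosh (max (a + x) 0 + max (b - x) 0) * Real.cosh (max (a + x) 0 - max (b - x) 0)
      ≤ (a + b) ^ 2 + rangeKernel (a + b) * Real.cosh (a + b) * Real.cosh (a - b + 2 * x) := by
  rcases le_total b x with h | h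
  · rw [max_eq_left (by linarith : 0 ≤ a + x), max_eq_right (by linarith : b - x ≤ 0)]
    have := range_step_of_exceed (add_nonneg ha hb) (sub_nonneg.2 h)
    convert this using 3 <;> ring_nf
  rcases le_total x (-a) with h' | h'
  · rw [max_eq_right (by linarith : a + x ≤ 0), max_eq_left (by linarith : 0 ≤ b - x)]
    have := range_step_of_exceed (add_nonneg ha hb) (by linarith : 0 ≤ -x - a)
    rw [← Real.cosh_neg (a - b + 2 * x), ← Real.cosh_neg (0 - (b - x))]
    convert this using 3 <;> ring_nf
  · rw [max_eq_left (by linarith : 0 ≤ a + x), max_eq_left (by linarith : 0 ≤ b - x)]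
    apply le_of_eq
    ring_nf

-- Range of a deterministic walk and its potential

/-- The height of the walk with steps `y` above its running minimum. -/
def walkAbove (y : ℕ → ℝ) : ℕ → ℝ
  | 0 => 0
  | k + 1 => max (walkAbove y k + y k) 0

/-- The range (maximum minus minimum) of the walk with steps `y` up to time `k`. The depth of the
walk below its running maximum is the height of the reflected walk above its running minimum. -/
def walkRange (y : ℕ → ℝ) (k : ℕ) : ℝ := walkAbove y k + walkAbove (-y) k

theorem walkAbove_nonneg (y : ℕ → ℝ) (k : ℕ) : 0 ≤ walkAbove y k := by
  cases k with
  | zero => exact le_rfl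
  | succ k => exact le_max_right _ _

theorem walkRange_nonneg (y : ℕ → ℝ) (k : ℕ) : 0 ≤ walkRange y k :=
  add_nonneg (walkAbove_nonneg _ _) (walkAbove_nonneg _ _)

theorem sum_sub_sum_le_walkAbove (y : ℕ → ℝ) {i k : ℕ} (h : i ≤ k) :
    ∑ l ∈ Finset.range k, y l - ∑ l ∈ Finset.range i, y l ≤ walkAbove y k := by
  induction k, h using Nat.le_induction with
  | base => simpa using walkAbove_nonneg y i
  | succ k hk ih =>
    rw [Finset.sum_range_succ]
    exact le_trans (by linarith) (le_max_left _ _)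

theorem exists_walkAbove_eq (y : ℕ → ℝ) (k : ℕ) : ∃ i ≤ k,
    walkAbove y k = ∑ l ∈ Finset.range k, y l - ∑ l ∈ Finset.range i, y l := by
  induction k with
  | zero => exact ⟨0, le_rfl, by simp [walkAbove]⟩
  | succ k ih =>
    obtain ⟨i, hi, h⟩ := ih
    rcases max_choice (walkAbove y k + y k) 0 with h' | h'
    · exact ⟨i, hi.trans k.le_succ, by rw [walkAbove, h', h, Finset.sum_range_succ]; ring⟩
    · exact ⟨k + 1, le_rfl, by rw [walkAbove, h', sub_self]⟩

theorem sum_sub_sum_le_walkRange (y : ℕ → ℝ) {i j k : ℕ} (hi : i ≤ k) (hj : j ≤ k) :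
    ∑ l ∈ Finset.range i, y l - ∑ l ∈ Finset.range j, y l ≤ walkRange y k := by
  have h1 := sum_sub_sum_le_walkAbove y hj
  have h2 := sum_sub_sum_le_walkAbove (-y) hi
  simp only [Pi.neg_apply, Finset.sum_neg_distrib] at h2
  unfold walkRange
  linarith

theorem exists_walkRange_eq (y : ℕ → ℝ) (k : ℕ) : ∃ i ≤ k, ∃ j ≤ k,
    walkRange y k = ∑ l ∈ Finset.range i, y l - ∑ l ∈ Finset.range j, y l := by
  obtain ⟨j, hj, h1⟩ := exists_walkAbove_eq y k
  obtain ⟨i, hi, h2⟩ := exists_walkAbove_eq (-y) k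
  refine ⟨i, hi, j, hj, ?_⟩
  simp only [Pi.neg_apply, Finset.sum_neg_distrib] at h2
  rw [walkRange, h1, h2]
  ring

theorem walkRange_mono (y : ℕ → ℝ) : Monotone (walkRange y) := by
  intro k m hkm
  obtain ⟨i, hi, j, hj, h⟩ := exists_walkRange_eq y k
  rw [h]
  exact sum_sub_sum_le_walkRange y (hi.trans hkm) (hj.trans hkm)

theorem walkAbove_mul {c : ℝ} (hc : 0 ≤ c) (y : ℕ → ℝ) (k : ℕ) :
    walkAbove (fun l ↦ c * y l) k = c * walkAbove y k := by
  induction k with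
  | zero => simp [walkAbove]
  | succ k ih => rw [walkAbove, walkAbove, ih, mul_max_of_nonneg _ _ hc, mul_zero, mul_add]

theorem walkRange_mul {c : ℝ} (hc : 0 ≤ c) (y : ℕ → ℝ) (k : ℕ) :
    walkRange (fun l ↦ c * y l) k = c * walkRange y k := by
  have : -(fun l ↦ c * y l) = fun l ↦ c * (-y) l := by ext; simp
  rw [walkRange, walkRange, this, walkAbove_mul hc, walkAbove_mul hc, mul_add]

/-- Subsampling a path at every `m`-th time does not increase its range. -/
theorem walkRange_subsample_le (S : ℕ → ℝ) (m k : ℕ) :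
    walkRange (fun l ↦ S (m * (l + 1)) - S (m * l)) k
      ≤ walkRange (fun l ↦ S (l + 1) - S l) (m * k) := by
  obtain ⟨i, hi, j, hj, h⟩ := exists_walkRange_eq (fun l ↦ S (m * (l + 1)) - S (m * l)) k
  have h' := sum_sub_sum_le_walkRange (fun l ↦ S (l + 1) - S l)
    (Nat.mul_le_mul_left m hi) (Nat.mul_le_mul_left m hj)
  rw [h]
  rw [Finset.sum_range_sub S, Finset.sum_range_sub S] at h'
  rw [Finset.sum_range_sub fun l ↦ S (m * l), Finset.sum_range_sub fun l ↦ S (m * l)]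
  simpa using h'

/-- The potential whose expectation controls the mean square range of a Gaussian walk. -/
noncomputable def walkPotential (y : ℕ → ℝ) (k : ℕ) : ℝ :=
  rangeKernel (walkRange y k) * Real.cosh (walkRange y k)
    * Real.cosh (walkAbove y k - walkAbove (-y) k)

/-- The addition formula for `cosh` separates the new step from the past; the `sinh` term will have
mean zero by symmetry. -/
theorem walkRange_sq_add_walkPotential_succ_le (y : ℕ → ℝ) (k : ℕ) :
    walkRange y (k + 1) ^ 2 + walkPotential y (k + 1) ≤ walkRange y k ^ 2
      + (walkPotential y k * Real.cosh (2 * y k)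
        + rangeKernel (walkRange y k) * Real.cosh (walkRange y k)
          * Real.sinh (walkAbove y k - walkAbove (-y) k) * Real.sinh (2 * y k)) := by
  have h := range_step (walkAbove_nonneg y k) (walkAbove_nonneg (-y) k) (y k)
  rw [Real.cosh_add (walkAbove y k - walkAbove (-y) k)] at h
  simp only [walkPotential, walkRange, walkAbove, Pi.neg_apply, ← sub_eq_add_neg] at h ⊢
  linarith

theorem walkPotential_nonneg (y : ℕ → ℝ) (k : ℕ) : 0 ≤ walkPotential y k :=
  mul_nonneg (mul_nonneg (rangeKernel_nonneg (walkRange_nonneg y k)) (Real.cosh_pos _).le)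
    (Real.cosh_pos _).le

theorem walkPotential_le (y : ℕ → ℝ) (k : ℕ) :
    walkPotential y k ≤ 2 * (1 + walkRange y k) := by
  have hr := walkRange_nonneg y k
  refine le_trans ?_ (rangeKernel_mul_cosh_sq_le hr)
  rw [sq, ← mul_assoc]
  refine mul_le_mul_of_nonneg_left ?_
    (mul_nonneg (rangeKernel_nonneg hr) (Real.cosh_pos _).le)
  rw [Real.cosh_le_cosh, abs_of_nonneg hr, abs_le, walkRange]
  constructor <;> linarith [walkAbove_nonneg y k, walkAbove_nonneg (-y) k]

theorem abs_walkPotential_conj_le (y : ℕ → ℝ) (k : ℕ) :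
    |rangeKernel (walkRange y k) * Real.cosh (walkRange y k)
      * Real.sinh (walkAbove y k - walkAbove (-y) k)| ≤ walkPotential y k := by
  have h := mul_nonneg (rangeKernel_nonneg (walkRange_nonneg y k))
    (Real.cosh_pos (walkRange y k)).le
  rw [abs_mul, abs_of_nonneg h, walkPotential]
  refine mul_le_mul_of_nonneg_left ?_ h
  rw [abs_le]
  constructor
  · have := Real.sinh_lt_cosh (-(walkAbove y k - walkAbove (-y) k))
    rw [Real.sinh_neg, Real.cosh_neg] at this
    linarith
  · exact (Real.sinh_lt_cosh _).le

-- Measurability and integrability of the walk functionals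

section Measurable

variable {Ω : Type*}

theorem measurable_walkAbove {m : MeasurableSpace Ω} {y : ℕ → Ω → ℝ} {k : ℕ}
    (h : ∀ l < k, Measurable[m] (y l)) : Measurable[m] fun ω ↦ walkAbove (fun l ↦ y l ω) k := by
  induction k with
  | zero => exact measurable_const
  | succ k ih =>
    exact ((ih fun l hl ↦ h l (hl.trans k.lt_succ_self)).add (h k k.lt_succ_self)).max
      measurable_const

theorem measurable_walkAbove_neg {m : MeasurableSpace Ω} {y : ℕ → Ω → ℝ} {k : ℕ}
    (h : ∀ l < k, Measurable[m] (y l)) :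
    Measurable[m] fun ω ↦ walkAbove (-fun l ↦ y l ω) k :=
  measurable_walkAbove (y := fun l ω ↦ -y l ω) fun l hl ↦ (h l hl).neg

theorem measurable_walkRange {m : MeasurableSpace Ω} {y : ℕ → Ω → ℝ} {k : ℕ}
    (h : ∀ l < k, Measurable[m] (y l)) : Measurable[m] fun ω ↦ walkRange (fun l ↦ y l ω) k :=
  (measurable_walkAbove h).add (measurable_walkAbove_neg h)

theorem measurable_walkPotential {m : MeasurableSpace Ω} {y : ℕ → Ω → ℝ} {k : ℕ}
    (h : ∀ l < k, Measurable[m] (y l)) :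
    Measurable[m] fun ω ↦ walkPotential (fun l ↦ y l ω) k :=
  ((continuous_rangeKernel.measurable.comp (measurable_walkRange h)).mul
    (Real.continuous_cosh.measurable.comp (measurable_walkRange h))).mul
    (Real.continuous_cosh.measurable.comp
      ((measurable_walkAbove h).sub (measurable_walkAbove_neg h)))

theorem measurable_walkPotential_conj {m : MeasurableSpace Ω} {y : ℕ → Ω → ℝ} {k : ℕ}
    (h : ∀ l < k, Measurable[m] (y l)) :
    Measurable[m] fun ω ↦ rangeKernel (walkRange (fun l ↦ y l ω) k)
      * Real.cosh (walkRange (fun l ↦ y l ω) k)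
      * Real.sinh (walkAbove (fun l ↦ y l ω) k - walkAbove (-fun l ↦ y l ω) k) :=
  ((continuous_rangeKernel.measurable.comp (measurable_walkRange h)).mul
    (Real.continuous_cosh.measurable.comp (measurable_walkRange h))).mul
    (Real.continuous_sinh.measurable.comp
      ((measurable_walkAbove h).sub (measurable_walkAbove_neg h)))

theorem memLp_walkAbove [MeasurableSpace Ω] {P : Measure Ω} [IsFiniteMeasure P] {y : ℕ → Ω → ℝ} {k : ℕ}
    (h : ∀ l < k, MemLp (y l) 2 P) : MemLp (fun ω ↦ walkAbove (fun l ↦ y l ω) k) 2 P := by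
  induction k with
  | zero => exact memLp_const 0
  | succ k ih =>
    exact ((ih fun l hl ↦ h l (hl.trans k.lt_succ_self)).add (h k k.lt_succ_self)).sup
      (memLp_const 0)

theorem memLp_walkRange [MeasurableSpace Ω] {P : Measure Ω} [IsFiniteMeasure P] {y : ℕ → Ω → ℝ} {k : ℕ}
    (h : ∀ l < k, MemLp (y l) 2 P) : MemLp (fun ω ↦ walkRange (fun l ↦ y l ω) k) 2 P :=
  (memLp_walkAbove h).add (memLp_walkAbove (y := fun l ω ↦ -y l ω) fun l hl ↦ (h l hl).neg)

end Measurable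

/-- Replaces a filtration: a functional of the earlier steps is independent of the current step. -/
theorem indepFun_of_measurable_iSup {Ω ι α β : Type*} {mΩ : MeasurableSpace Ω} {P : Measure Ω}
    [MeasurableSpace α] [MeasurableSpace β] {X : ι → Ω → α} (hX : iIndepFun X P)
    (hm : ∀ i, Measurable (X i)) {S : Set ι} {i : ι} (hi : i ∉ S) {f : Ω → β}
    (hf : Measurable[⨆ p ∈ S, MeasurableSpace.comap (X p) inferInstance] f) :
    IndepFun f (X i) P := by
  have h := indep_iSup_of_disjoint (fun i ↦ (hm i).comap_le) hX
    (Set.disjoint_singleton_right.2 hi)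
  rw [iSup_singleton] at h
  exact indep_of_indep_of_le_left h hf.comap_le

theorem measurable_iSup_comap {Ω ι α : Type*} [MeasurableSpace α] (X : ι → Ω → α) {S : Set ι}
    {i : ι} (hi : i ∈ S) :
    Measurable[⨆ p ∈ S, MeasurableSpace.comap (X p) inferInstance] (X i) :=
  (comap_measurable (X i)).mono (le_biSup (fun p ↦ MeasurableSpace.comap (X p) inferInstance) hi)
    le_rfl

-- Expected one-step inequality for Gaussian walks

/-- The law of a sequence of independent standard real Gaussian variables. -/
noncomputable abbrev gaussianNoise : Measure (ℕ → ℝ) :=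
  Measure.infinitePi fun _ : ℕ ↦ gaussianReal 0 1

theorem iIndepFun_gaussianNoise : iIndepFun (fun (l : ℕ) (x : ℕ → ℝ) ↦ x l) gaussianNoise :=
  iIndepFun_infinitePi (X := fun _ x ↦ x) fun _ ↦ measurable_id

theorem hasLaw_gaussianNoise (l : ℕ) :
    HasLaw (fun x : ℕ → ℝ ↦ x l) (gaussianReal 0 1) gaussianNoise :=
  (measurePreserving_eval_infinitePi (fun _ : ℕ ↦ gaussianReal 0 1) l).hasLaw

theorem integrable_exp_mul_of_hasLaw {Ω : Type*} [MeasurableSpace Ω] {P : Measure Ω}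
    {X : Ω → ℝ} (hX : HasLaw X (gaussianReal 0 1) P) (t : ℝ) :
    Integrable (fun ω ↦ Real.exp (t * X ω)) P := by
  have h := integrable_exp_mul_gaussianReal (μ := 0) (v := 1) t
  rw [← hX.map_eq] at h
  exact h.comp_aemeasurable hX.aemeasurable

theorem integral_exp_mul_of_hasLaw {Ω : Type*} [MeasurableSpace Ω] {P : Measure Ω}
    {X : Ω → ℝ} (hX : HasLaw X (gaussianReal 0 1) P) (t : ℝ) :
    ∫ ω, Real.exp (t * X ω) ∂P = Real.exp (t ^ 2 / 2) := by
  have h := mgf_gaussianReal hX.map_eq t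
  simpa [mgf] using h

theorem integrable_cosh_mul_of_hasLaw {Ω : Type*} [MeasurableSpace Ω] {P : Measure Ω}
    {X : Ω → ℝ} (hX : HasLaw X (gaussianReal 0 1) P) (t : ℝ) :
    Integrable (fun ω ↦ Real.cosh (t * X ω)) P := by
  simp only [Real.cosh_eq, ← neg_mul]
  exact ((integrable_exp_mul_of_hasLaw hX t).add
    (integrable_exp_mul_of_hasLaw hX (-t))).div_const 2

theorem integrable_sinh_mul_of_hasLaw {Ω : Type*} [MeasurableSpace Ω] {P : Measure Ω}
    {X : Ω → ℝ} (hX : HasLaw X (gaussianReal 0 1) P) (t : ℝ) :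
    Integrable (fun ω ↦ Real.sinh (t * X ω)) P := by
  simp only [Real.sinh_eq, ← neg_mul]
  exact ((integrable_exp_mul_of_hasLaw hX t).sub
    (integrable_exp_mul_of_hasLaw hX (-t))).div_const 2

theorem integral_cosh_mul_of_hasLaw {Ω : Type*} [MeasurableSpace Ω] {P : Measure Ω}
    {X : Ω → ℝ} (hX : HasLaw X (gaussianReal 0 1) P) (t : ℝ) :
    ∫ ω, Real.cosh (t * X ω) ∂P = Real.exp (t ^ 2 / 2) := by
  simp only [Real.cosh_eq, ← neg_mul]
  rw [integral_div, integral_add (integrable_exp_mul_of_hasLaw hX t)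
    (integrable_exp_mul_of_hasLaw hX (-t)), integral_exp_mul_of_hasLaw hX,
    integral_exp_mul_of_hasLaw hX, neg_sq]
  ring

theorem integral_sinh_mul_of_hasLaw {Ω : Type*} [MeasurableSpace Ω] {P : Measure Ω}
    {X : Ω → ℝ} (hX : HasLaw X (gaussianReal 0 1) P) (t : ℝ) :
    ∫ ω, Real.sinh (t * X ω) ∂P = 0 := by
  simp only [Real.sinh_eq, ← neg_mul]
  rw [integral_div, integral_sub (integrable_exp_mul_of_hasLaw hX t)
    (integrable_exp_mul_of_hasLaw hX (-t)), integral_exp_mul_of_hasLaw hX,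
    integral_exp_mul_of_hasLaw hX, neg_sq]
  ring

theorem memLp_gaussianNoise (s : ℝ) (l : ℕ) :
    MemLp (fun x : ℕ → ℝ ↦ s * x l) 2 gaussianNoise := by
  have h : MemLp id 2 (gaussianReal 0 1) := memLp_id_gaussianReal 2
  exact (h.comp_measurePreserving
    (measurePreserving_eval_infinitePi (fun _ : ℕ ↦ gaussianReal 0 1) l)).const_mul s

theorem measurable_scaled_noise (s : ℝ) (k : ℕ) :
    ∀ l < k, Measurable fun x : ℕ → ℝ ↦ s * x l :=
  fun l _ ↦ measurable_const.mul (measurable_pi_apply l)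

theorem memLp_walkRange_noise (s : ℝ) (k : ℕ) :
    MemLp (fun x : ℕ → ℝ ↦ walkRange (fun l ↦ s * x l) k) 2 gaussianNoise :=
  memLp_walkRange fun l _ ↦ memLp_gaussianNoise s l

theorem integrable_walkPotential_noise (s : ℝ) (k : ℕ) :
    Integrable (fun x : ℕ → ℝ ↦ walkPotential (fun l ↦ s * x l) k) gaussianNoise := by
  have h := (memLp_walkRange_noise s k).integrable one_le_two
  refine (((integrable_const 1).add h).const_mul 2).mono'
    (measurable_walkPotential (measurable_scaled_noise s k)).aestronglyMeasurable
    (Filter.Eventually.of_forall fun x ↦ ?_)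
  rw [Real.norm_of_nonneg (walkPotential_nonneg _ _)]
  exact walkPotential_le _ _

/-- The step `s * x k` is independent of the past, with `E cosh (2 s x_k) = exp (2s²)` and `E sinh
(2 s x_k) = 0`. -/
theorem integral_walkRange_sq_add_walkPotential_succ_le (s : ℝ) (k : ℕ) :
    ∫ x, walkRange (fun l ↦ s * x l) (k + 1) ^ 2 ∂gaussianNoise
        + ∫ x, walkPotential (fun l ↦ s * x l) (k + 1) ∂gaussianNoise
      ≤ ∫ x, walkRange (fun l ↦ s * x l) k ^ 2 ∂gaussianNoise
        + Real.exp (2 * s ^ 2) * ∫ x, walkPotential (fun l ↦ s * x l) k ∂gaussianNoise := by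
  have hlaw := hasLaw_gaussianNoise k
  have hmeas (l) (hl : l < k) : Measurable[⨆ p ∈ Set.Iio k, MeasurableSpace.comap
      (fun x : ℕ → ℝ ↦ x p) inferInstance] fun x : ℕ → ℝ ↦ s * x l :=
    (measurable_iSup_comap (fun (l : ℕ) (x : ℕ → ℝ) ↦ x l) (Set.mem_Iio.2 hl)).const_mul s
  have hk : k ∉ Set.Iio k := by simp
  have hi1 := indepFun_of_measurable_iSup iIndepFun_gaussianNoise
    (fun l ↦ measurable_pi_apply l) hk (measurable_walkPotential hmeas)
  have hi2 := indepFun_of_measurable_iSup iIndepFun_gaussianNoise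
    (fun l ↦ measurable_pi_apply l) hk (measurable_walkPotential_conj hmeas)
  have hc : Measurable fun z : ℝ ↦ Real.cosh (2 * s * z) := by fun_prop
  have hs : Measurable fun z : ℝ ↦ Real.sinh (2 * s * z) := by fun_prop
  have hi1' := hi1.comp measurable_id hc
  have hi2' := hi2.comp measurable_id hs
  simp only [Function.comp_def, id] at hi1' hi2'
  have hpot := integrable_walkPotential_noise s k
  have hconj := hpot.mono' (measurable_walkPotential_conj
    (measurable_scaled_noise s k)).aestronglyMeasurable
    (Filter.Eventually.of_forall fun x ↦ abs_walkPotential_conj_le (fun l ↦ s * x l) k)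
  have hint1 := hi1'.integrable_mul hpot (integrable_cosh_mul_of_hasLaw hlaw (2 * s))
  have hint2 := hi2'.integrable_mul hconj (integrable_sinh_mul_of_hasLaw hlaw (2 * s))
  have he1 := hi1'.integral_fun_mul_eq_mul_integral hpot.aestronglyMeasurable
    (integrable_cosh_mul_of_hasLaw hlaw (2 * s)).aestronglyMeasurable
  have he2 := hi2'.integral_fun_mul_eq_mul_integral hconj.aestronglyMeasurable
    (integrable_sinh_mul_of_hasLaw hlaw (2 * s)).aestronglyMeasurable
  simp only [Pi.mul_def] at hint1 hint2
  rw [integral_cosh_mul_of_hasLaw hlaw] at he1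
  rw [integral_sinh_mul_of_hasLaw hlaw, mul_zero] at he2
  have hR (k) := (memLp_walkRange_noise s k).integrable_sq
  rw [← integral_add (hR (k + 1)) (integrable_walkPotential_noise s (k + 1))]
  calc _ ≤ ∫ x, (walkRange (fun l ↦ s * x l) k ^ 2
      + (walkPotential (fun l ↦ s * x l) k * Real.cosh (2 * s * x k)
        + rangeKernel (walkRange (fun l ↦ s * x l) k)
          * Real.cosh (walkRange (fun l ↦ s * x l) k)
          * Real.sinh (walkAbove (fun l ↦ s * x l) k - walkAbove (-fun l ↦ s * x l) k)
          * Real.sinh (2 * s * x k))) ∂gaussianNoise := by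
        refine integral_mono ((hR (k + 1)).add (integrable_walkPotential_noise s (k + 1)))
          ((hR k).add (hint1.add hint2)) fun x ↦ ?_
        have := walkRange_sq_add_walkPotential_succ_le (fun l ↦ s * x l) k
        simpa only [mul_assoc] using this
    _ = _ := by
        refine (integral_add (hR k) (hint1.add hint2)).trans ?_
        rw [integral_add' hint1 hint2, he1, he2]
        ring_nf

-- Linear growth of the mean square range

/-- The mean square range of the standard Gaussian walk at time `k`. -/
noncomputable def gaussianWalkRangeSq (k : ℕ) : ℝ :=
  ∫ x, walkRange x k ^ 2 ∂gaussianNoise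

theorem integral_walkRange_mul_sq {s : ℝ} (hs : 0 ≤ s) (k : ℕ) :
    ∫ x, walkRange (fun l ↦ s * x l) k ^ 2 ∂gaussianNoise = s ^ 2 * gaussianWalkRangeSq k := by
  simp only [walkRange_mul hs, mul_pow]
  rw [integral_const_mul, gaussianWalkRangeSq]

theorem gaussianWalkRangeSq_mono : Monotone gaussianWalkRangeSq := by
  intro k m hkm
  have h (k) := (memLp_walkRange_noise 1 k).integrable_sq
  simp only [one_mul] at h
  exact integral_mono (h k) (h m) fun x ↦
    pow_le_pow_left₀ (walkRange_nonneg x k) (walkRange_mono x hkm) 2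

/-- Discounting by `exp (-2s²)` per step makes the one-step inequalities telescope; the total is
bounded by the initial potential `rangeKernel 0`. -/
theorem sum_exp_mul_gaussianWalkRangeSq_le {s : ℝ} (hs : 0 ≤ s) (K : ℕ) :
    ∑ k ∈ Finset.range K, Real.exp (-(2 * s ^ 2)) ^ (k + 1)
      * (s ^ 2 * (gaussianWalkRangeSq (k + 1) - gaussianWalkRangeSq k)) ≤ 2 * Real.log 2 := by
  set q := Real.exp (-(2 * s ^ 2)) with hq
  have hq0 : 0 < q := Real.exp_pos _
  have hq1 : q * Real.exp (2 * s ^ 2) = 1 := by rw [hq, ← Real.exp_add]; simp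
  suffices h : ∑ k ∈ Finset.range K, q ^ (k + 1)
      * (s ^ 2 * (gaussianWalkRangeSq (k + 1) - gaussianWalkRangeSq k))
      + q ^ K * ∫ x, walkPotential (fun l ↦ s * x l) K ∂gaussianNoise ≤ 2 * Real.log 2 by
    have : 0 ≤ q ^ K * ∫ x, walkPotential (fun l ↦ s * x l) K ∂gaussianNoise :=
      mul_nonneg (by positivity) (integral_nonneg fun x ↦ walkPotential_nonneg _ _)
    linarith
  induction K with
  | zero =>
    simp [walkPotential, walkRange, walkAbove, rangeKernel_zero]
  | succ K ih =>
    have h := integral_walkRange_sq_add_walkPotential_succ_le s K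
    rw [integral_walkRange_mul_sq hs, integral_walkRange_mul_sq hs] at h
    have h' := mul_le_mul_of_nonneg_left h (pow_pos hq0 (K + 1)).le
    rw [Finset.sum_range_succ]
    have e : q ^ (K + 1) * (Real.exp (2 * s ^ 2)
        * ∫ x, walkPotential (fun l ↦ s * x l) K ∂gaussianNoise)
        = q ^ K * ∫ x, walkPotential (fun l ↦ s * x l) K ∂gaussianNoise := by
      rw [pow_succ]; linear_combination (q ^ K * ∫ x, walkPotential (fun l ↦ s * x l) K
        ∂gaussianNoise) * hq1
    rw [mul_add, mul_add, e] at h'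
    linarith

/-- An Abelian estimate: discounted increments of a superadditive monotone sequence. -/
theorem mul_sum_pow_le_sum_increments {u : ℕ → ℝ} (hu : Monotone u) (hu0 : u 0 = 0) {j : ℕ}
    (hsup : ∀ m : ℕ, m * u j ≤ u (j * m)) {q : ℝ} (hq0 : 0 ≤ q) (hq1 : q ≤ 1) (J : ℕ) :
    u j * ∑ m ∈ Finset.range J, (q ^ j) ^ (m + 1)
      ≤ ∑ k ∈ Finset.range (j * J), q ^ (k + 1) * (u (k + 1) - u k) := by
  set p := q ^ j with hp
  have hp0 : 0 ≤ p := pow_nonneg hq0 j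
  have hp1 : p ≤ 1 := pow_le_one₀ hq0 hq1
  have h1 (J : ℕ) : ∑ m ∈ Finset.range J, p ^ (m + 1) * (u (j * (m + 1)) - u (j * m))
      ≤ ∑ k ∈ Finset.range (j * J), q ^ (k + 1) * (u (k + 1) - u k) := by
    induction J with
    | zero => simp
    | succ J ih =>
      rw [Finset.sum_range_succ, mul_add, mul_one, Finset.sum_range_add]
      refine add_le_add ih ?_
      rw [← mul_one j, mul_assoc, one_mul, ← mul_add, mul_one]
      have : u (j * (J + 1)) - u (j * J)
          = ∑ l ∈ Finset.range j, (u (j * J + l + 1) - u (j * J + l)) := by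
        exact (Finset.sum_range_sub (fun l ↦ u (j * J + l)) j).symm
      rw [this, Finset.mul_sum]
      refine Finset.sum_le_sum fun l hl ↦ mul_le_mul_of_nonneg_right ?_
        (sub_nonneg.2 (hu (Nat.le_succ _)))
      rw [hp, ← pow_mul]
      refine pow_le_pow_of_le_one hq0 hq1 ?_
      rw [mul_add, mul_one]
      have := Finset.mem_range.1 hl
      omega
  refine le_trans ?_ (h1 J)
  -- Summation by parts; the remainder on the right is nonnegative by superadditivity.
  have h2 (J : ℕ) : ∑ m ∈ Finset.range J, p ^ (m + 1) * (u (j * (m + 1)) - u (j * m))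
      - u j * ∑ m ∈ Finset.range J, p ^ (m + 1) ≥ p ^ J * (u (j * J) - J * u j) := by
    induction J with
    | zero => simp [hu0]
    | succ J ih =>
      rw [Finset.sum_range_succ, Finset.sum_range_succ]
      have h3 : p ^ (J + 1) * (u (j * J) - J * u j) ≤ p ^ J * (u (j * J) - J * u j) :=
        mul_le_mul_of_nonneg_right (pow_le_pow_of_le_one hp0 hp1 J.le_succ)
          (sub_nonneg.2 (hsup J))
      push_cast
      linarith
  have h4 := mul_nonneg (pow_nonneg hp0 J) (sub_nonneg.2 (hsup J))
  linarith [h2 J]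

/-- For step variance `t`, the Abelian estimate bounds `t * gaussianWalkRangeSq j` by `2 log 2 (exp
(2tj) - 1)`. Both sides vanish at `t = 0`, and comparing their derivatives there gives the claim. -/
theorem gaussianWalkRangeSq_le_of_superadditive {j : ℕ} (hj : 0 < j)
    (hsup : ∀ m : ℕ, m * gaussianWalkRangeSq j ≤ gaussianWalkRangeSq (j * m)) :
    gaussianWalkRangeSq j ≤ 4 * Real.log 2 * j := by
  have hu0 : gaussianWalkRangeSq 0 = 0 := by simp [gaussianWalkRangeSq, walkRange, walkAbove]
  have hj' : (0 : ℝ) < j := by exact_mod_cast hj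
  have hunn : 0 ≤ gaussianWalkRangeSq j := hu0 ▸ gaussianWalkRangeSq_mono j.zero_le
  have key (t : ℝ) (ht : 0 < t) :
      t * gaussianWalkRangeSq j ≤ 2 * Real.log 2 * (Real.exp (2 * t * j) - 1) := by
    set p := Real.exp (-(2 * t)) ^ j with hp
    have hpe : p = Real.exp (-(2 * t * j)) := by
      rw [hp, ← Real.exp_nat_mul]; ring_nf
    have hp0 : 0 < p := by rw [hpe]; exact Real.exp_pos _
    have hp1 : p < 1 := by rw [hpe]; exact Real.exp_lt_one_iff.2 (by have := mul_pos ht hj'; linarith)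
    have hfin (J : ℕ) : t * gaussianWalkRangeSq j * ∑ m ∈ Finset.range J, p ^ (m + 1)
        ≤ 2 * Real.log 2 := by
      have h1 := sum_exp_mul_gaussianWalkRangeSq_le (Real.sqrt_nonneg t) (j * J)
      have h2 := mul_sum_pow_le_sum_increments gaussianWalkRangeSq_mono hu0 hsup
        (Real.exp_pos (-(2 * t))).le (Real.exp_le_one_iff.2 (by linarith)) J
      rw [Real.sq_sqrt ht.le] at h1
      have h3 := mul_le_mul_of_nonneg_left h2 ht.le
      rw [mul_assoc]
      refine h3.trans (le_trans (le_of_eq ?_) h1)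
      rw [Finset.mul_sum]
      exact Finset.sum_congr rfl fun k _ ↦ by ring
    have hlim := ((hasSum_geometric_of_lt_one hp0.le hp1).mul_left p).tendsto_sum_nat
    have hle := le_of_tendsto' (hlim.const_mul (t * gaussianWalkRangeSq j)) fun J ↦ by
      simpa only [pow_succ'] using hfin J
    have h1p : 0 < 1 - p := by linarith
    have hpe' : p * Real.exp (2 * t * j) = 1 := by rw [hpe, ← Real.exp_add]; simp
    -- The geometric series sums to `p / (1 - p) = 1 / (exp (2tj) - 1)`.
    have e : p * (1 - p)⁻¹ * (Real.exp (2 * t * j) - 1) = 1 := by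
      field_simp
      linear_combination hpe'
    have hE : 0 < Real.exp (2 * t * j) - 1 := by
      rw [sub_pos, Real.one_lt_exp_iff]; positivity
    have := mul_le_mul_of_nonneg_right hle hE.le
    rwa [mul_assoc, e, mul_one] at this
  have hder : HasDerivAt (fun t : ℝ ↦ 2 * Real.log 2 * (Real.exp (2 * t * j) - 1)
      - t * gaussianWalkRangeSq j) (4 * Real.log 2 * j - gaussianWalkRangeSq j) 0 := by
    have h1 : HasDerivAt (fun t : ℝ ↦ 2 * t * j) (2 * j) 0 := by
      simpa using ((hasDerivAt_id (0 : ℝ)).const_mul 2).mul_const (j : ℝ)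
    have h2 := ((h1.exp.sub_const 1).const_mul (2 * Real.log 2)).sub
      ((hasDerivAt_id (0 : ℝ)).mul_const (gaussianWalkRangeSq j))
    refine h2.congr_deriv ?_
    simp
    ring
  have hslope := hder.hasDerivWithinAt (s := Set.Ioi 0)
  rw [hasDerivWithinAt_iff_tendsto_slope' (by simp)] at hslope
  have := ge_of_tendsto hslope (b := 0) (by
    filter_upwards [self_mem_nhdsWithin] with t ht
    have ht' : (0 : ℝ) < t := ht
    rw [slope_def_field]
    have := key t ht'
    refine div_nonneg ?_ (by simpa using ht'.le)
    simp
    linarith)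
  linarith

-- Gaussian walks inside Brownian motion

section BrownianIncrements

variable {Ω : Type*} [MeasurableSpace Ω] {P : Measure Ω}

theorem ProbabilityTheory.IsPreBrownianReal.hasLaw_unit_increments {B : ℝ≥0 → Ω → ℝ}
    (hB : IsPreBrownianReal B P) :
    HasLaw (fun ω (l : ℕ) ↦ B ((l : ℝ≥0) + 1) ω - B l ω) gaussianNoise P := by
  have hind := hB.hasIndepIncrements.nat (t := fun l : ℕ ↦ (l : ℝ≥0)) Nat.mono_cast
  have hlaw (l : ℕ) : HasLaw (fun ω ↦ B ((l + 1 : ℕ) : ℝ≥0) ω - B l ω) (gaussianReal 0 1) P := by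
    have h := hB.hasLaw_sub ((l + 1 : ℕ) : ℝ≥0) (l : ℝ≥0)
    have e : nndist (((l + 1 : ℕ) : ℝ≥0) : ℝ) ((l : ℝ≥0) : ℝ) = 1 := by
      ext
      simp
    have e' : nndist (((l + 1 : ℕ) : ℝ≥0).1) ((l : ℝ≥0).1) = 1 := e
    rw [e'] at h
    exact h
  have h := hind.hasLaw_infinitePi hlaw (aemeasurable_pi_iff.2 fun l ↦ (hlaw l).aemeasurable)
  simpa only [Nat.cast_add, Nat.cast_one] using h

theorem ProbabilityTheory.IsPreBrownianReal.hasLaw_increments {B : ℝ≥0 → Ω → ℝ}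
    (hB : IsPreBrownianReal B P) {c : ℝ≥0} (hc : c ≠ 0) :
    HasLaw (fun ω (l : ℕ) ↦ (√c)⁻¹ * (B (c * (l + 1)) ω - B (c * l) ω)) gaussianNoise P := by
  simpa only [mul_sub] using (hB.smul hc).hasLaw_unit_increments

theorem ProbabilityTheory.IsPreBrownianReal.memLp_walkRange_increments {B : ℝ≥0 → Ω → ℝ}
    (hB : IsPreBrownianReal B P) (c : ℝ≥0) (k : ℕ) :
    MemLp (fun ω ↦ walkRange (fun l ↦ B (c * (l + 1)) ω - B (c * l) ω) k) 2 P := by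
  have := hB.isGaussianProcess.isProbabilityMeasure
  exact memLp_walkRange (y := fun (l : ℕ) ω ↦ B (c * (l + 1)) ω - B (c * l) ω) fun l _ ↦
    (hB.isGaussianProcess.hasGaussianLaw_eval _).memLp_two.sub
      (hB.isGaussianProcess.hasGaussianLaw_eval _).memLp_two

theorem ProbabilityTheory.IsPreBrownianReal.integral_walkRange_increments {B : ℝ≥0 → Ω → ℝ}
    (hB : IsPreBrownianReal B P) {c : ℝ≥0} (hc : c ≠ 0) (k : ℕ) :
    ∫ ω, walkRange (fun l ↦ B (c * (l + 1)) ω - B (c * l) ω) k ^ 2 ∂P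
      = c * gaussianWalkRangeSq k := by
  have hs : √(c : ℝ) ≠ 0 := by
    rw [Real.sqrt_ne_zero']
    exact_mod_cast pos_of_ne_zero hc
  have hm : Measurable fun x : ℕ → ℝ ↦ walkRange (fun l ↦ √c * x l) k ^ 2 :=
    (measurable_walkRange (measurable_scaled_noise _ k)).pow_const 2
  have h := (hB.hasLaw_increments hc).integral_comp hm.aestronglyMeasurable
  rw [integral_walkRange_mul_sq (Real.sqrt_nonneg _), Real.sq_sqrt c.coe_nonneg] at h
  rw [← h]
  simp only [Function.comp_def, mul_inv_cancel_left₀ hs]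

/-- Superadditivity comes from viewing one path on two grids: mesh `m` has mean square range `m *
gaussianWalkRangeSq j` by scaling, and refining to mesh `1` can only enlarge the range. -/
theorem ProbabilityTheory.IsPreBrownianReal.gaussianWalkRangeSq_le {B : ℝ≥0 → Ω → ℝ}
    (hB : IsPreBrownianReal B P) {j : ℕ} (hj : 0 < j) :
    gaussianWalkRangeSq j ≤ 4 * Real.log 2 * j := by
  refine gaussianWalkRangeSq_le_of_superadditive hj fun m ↦ ?_
  rcases Nat.eq_zero_or_pos m with rfl | hm
  · simp [gaussianWalkRangeSq, walkRange, walkAbove]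
  have h1 := hB.integral_walkRange_increments (c := m) (by exact_mod_cast hm.ne') j
  have h2 := hB.integral_walkRange_increments one_ne_zero (m * j)
  have hle : ∫ ω, walkRange (fun l ↦ B ((m : ℝ≥0) * (l + 1)) ω - B (m * l) ω) j ^ 2 ∂P
      ≤ ∫ ω, walkRange (fun l ↦ B (1 * ((l : ℝ≥0) + 1)) ω - B (1 * l) ω) (m * j) ^ 2 ∂P := by
    refine integral_mono (hB.memLp_walkRange_increments _ j).integrable_sq
      (hB.memLp_walkRange_increments _ _).integrable_sq fun ω ↦ ?_
    refine pow_le_pow_left₀ (walkRange_nonneg _ _) ?_ 2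
    have := walkRange_subsample_le (fun l : ℕ ↦ B l ω) m j
    simpa using this
  rw [h1, h2] at hle
  simpa [mul_comm m j] using hle

/-- The range of a Brownian path over a grid of mesh `c` with `k` steps has mean square at most
`4 log 2` times the elapsed time. -/
theorem ProbabilityTheory.IsPreBrownianReal.integral_walkRange_increments_le
    {B : ℝ≥0 → Ω → ℝ} (hB : IsPreBrownianReal B P) {c : ℝ≥0} (hc : c ≠ 0) {k : ℕ} (hk : 0 < k) :
    ∫ ω, walkRange (fun l ↦ B (c * (l + 1)) ω - B (c * l) ω) k ^ 2 ∂P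
      ≤ 4 * Real.log 2 * (c * k) := by
  rw [hB.integral_walkRange_increments hc]
  have := mul_le_mul_of_nonneg_left (hB.gaussianWalkRangeSq_le hk) c.coe_nonneg
  calc _ ≤ _ := this
    _ = _ := by ring

/-- The law of a sequence of independent standard Gaussian vectors in `ℝⁿ`. -/
noncomputable abbrev gaussianVectorNoise (n : ℕ) : Measure (Fin n → ℕ → ℝ) :=
  Measure.infinitePi fun _ : Fin n ↦ gaussianNoise

theorem IsBrownianMotion.hasLaw_increments {n : ℕ} {W : ℝ≥0 → Ω → EuclideanSpace ℝ (Fin n)}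
    (hW : IsBrownianMotion W P) {c : ℝ≥0} (hc : c ≠ 0) :
    HasLaw (fun ω (j : Fin n) (l : ℕ) ↦ (√c)⁻¹ * (W (c * (l + 1)) ω j - W (c * l) ω j))
      (gaussianVectorNoise n) P := by
  have hg : Measurable fun (w : ℝ≥0 → ℝ) (l : ℕ) ↦ (√c)⁻¹ * (w (c * (l + 1)) - w (c * l)) := by
    fun_prop
  have hlaw (j : Fin n) := (hW.isBrownianReal_coord j).toIsPreBrownianReal.hasLaw_increments hc
  exact (hW.iIndepFun_coord.comp _ fun _ ↦ hg).hasLaw_infinitePi hlaw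
    (aemeasurable_pi_iff.2 fun j ↦ (hlaw j).aemeasurable)

end BrownianIncrements

-- Exit of the Gaussian walk from a ball

/-- The squared norm at time `k` of the walk in `ℝⁿ` with step coordinates `x`. -/
def walkNormSq {n : ℕ} (x : Fin n → ℕ → ℝ) (k : ℕ) : ℝ :=
  ∑ j, (∑ l ∈ Finset.range k, x j l) ^ 2

open Classical in
/-- The indicator that the walk with step coordinates `x` has squared norm less than `ρ` up to
time `k`. -/
noncomputable def walkStays {n : ℕ} (ρ : ℝ) (x : Fin n → ℕ → ℝ) (k : ℕ) : ℝ :=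
  if ∀ i ≤ k, walkNormSq x i < ρ then 1 else 0

theorem walkNormSq_succ {n : ℕ} (x : Fin n → ℕ → ℝ) (k : ℕ) :
    walkNormSq x (k + 1) - walkNormSq x k
      = ∑ j, (2 * (∑ l ∈ Finset.range k, x j l) * x j k + x j k ^ 2) := by
  rw [walkNormSq, walkNormSq, ← Finset.sum_sub_distrib]
  refine Finset.sum_congr rfl fun j _ ↦ ?_
  rw [Finset.sum_range_succ]
  ring

/-- Young's inequality with parameter `δ` absorbs the cross term; a second use trades the squared
step length for `δ * ρ` plus a multiple of its square over `ρ`, and Cauchy–Schwarz brings in the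
fourth powers. -/
theorem walkNormSq_succ_le {n : ℕ} (x : Fin n → ℕ → ℝ) {k : ℕ} {ρ δ : ℝ} (hρ : 0 < ρ)
    (hδ : 0 < δ) (h : walkNormSq x k < ρ) :
    walkNormSq x (k + 1) ≤ (1 + 2 * δ) * ρ
      + (1 + 1 / δ) ^ 2 / (4 * δ) * (n / ρ) * ∑ j, x j k ^ 4 := by
  set z := ∑ j, x j k ^ 2 with hz
  have h1 : walkNormSq x (k + 1) ≤ (1 + δ) * walkNormSq x k + (1 + 1 / δ) * z := by
    rw [walkNormSq, walkNormSq, hz, Finset.mul_sum, Finset.mul_sum, ← Finset.sum_add_distrib]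
    refine Finset.sum_le_sum fun j _ ↦ ?_
    rw [Finset.sum_range_succ]
    set S := ∑ l ∈ Finset.range k, x j l
    have : 0 ≤ (δ * S - x j k) ^ 2 / δ := by positivity
    have e : (δ * S - x j k) ^ 2 / δ = δ * S ^ 2 - 2 * S * x j k + 1 / δ * x j k ^ 2 := by
      field_simp; ring
    rw [e] at this
    linarith
  have h2 : z ^ 2 ≤ n * ∑ j, x j k ^ 4 := by
    have := sq_sum_le_card_mul_sum_sq (s := Finset.univ) (f := fun j ↦ x j k ^ 2)
    simpa [← pow_mul] using this
  have h3 : (1 + 1 / δ) * z ≤ δ * ρ + (1 + 1 / δ) ^ 2 / (4 * δ) * (1 / ρ) * z ^ 2 := by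
    have : 0 ≤ ((1 + 1 / δ) * z - 2 * δ * ρ) ^ 2 / (4 * δ * ρ) := by positivity
    have e : ((1 + 1 / δ) * z - 2 * δ * ρ) ^ 2 / (4 * δ * ρ)
        = (1 + 1 / δ) ^ 2 / (4 * δ) * (1 / ρ) * z ^ 2 - (1 + 1 / δ) * z + δ * ρ := by
      generalize 1 + 1 / δ = D
      field_simp; ring
    rw [e] at this
    linarith
  have h4 : (1 + 1 / δ) ^ 2 / (4 * δ) * (1 / ρ) * z ^ 2
      ≤ (1 + 1 / δ) ^ 2 / (4 * δ) * (1 / ρ) * (n * ∑ j, x j k ^ 4) :=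
    mul_le_mul_of_nonneg_left h2 (by positivity)
  have h5 : (1 + δ) * walkNormSq x k ≤ (1 + δ) * ρ :=
    mul_le_mul_of_nonneg_left h.le (by positivity)
  have e : (1 + 1 / δ) ^ 2 / (4 * δ) * (1 / ρ) * (n * ∑ j, x j k ^ 4)
      = (1 + 1 / δ) ^ 2 / (4 * δ) * (n / ρ) * ∑ j, x j k ^ 4 := by ring
  linarith

/-- The squared norm of the walk stopped on leaving the ball exceeds the squared radius only by
the contribution of a single step. -/
theorem sum_walkStays_mul_le {n : ℕ} (x : Fin n → ℕ → ℝ) {ρ δ : ℝ} (hρ : 0 < ρ)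
    (hδ : 0 < δ) (K : ℕ) :
    ∑ k ∈ Finset.range K, walkStays ρ x k * (walkNormSq x (k + 1) - walkNormSq x k)
      ≤ (1 + 2 * δ) * ρ
        + (1 + 1 / δ) ^ 2 / (4 * δ) * (n / ρ) * ∑ k ∈ Finset.range K, ∑ j, x j k ^ 4 := by
  -- The induction also needs that the sum telescopes to the squared norm as long as the walk has
  -- not left the ball; afterwards the sum is frozen.
  suffices h : ((∀ i ≤ K, walkNormSq x i < ρ) → ∑ k ∈ Finset.range K, walkStays ρ x k
      * (walkNormSq x (k + 1) - walkNormSq x k) = walkNormSq x K) ∧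
      ∑ k ∈ Finset.range K, walkStays ρ x k * (walkNormSq x (k + 1) - walkNormSq x k)
      ≤ (1 + 2 * δ) * ρ + (1 + 1 / δ) ^ 2 / (4 * δ) * (n / ρ)
        * ∑ k ∈ Finset.range K, ∑ j, x j k ^ 4 from h.2
  have hC : 0 ≤ (1 + 1 / δ) ^ 2 / (4 * δ) * (n / ρ) := by positivity
  induction K with
  | zero => exact ⟨fun _ ↦ by simp [walkNormSq], by simp; positivity⟩
  | succ K ih =>
    obtain ⟨ih1, ih2⟩ := ih
    rw [Finset.sum_range_succ, Finset.sum_range_succ, mul_add]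
    have h4 (k : ℕ) : 0 ≤ ∑ j, x j k ^ 4 := Finset.sum_nonneg fun j _ ↦ by positivity
    by_cases hK : ∀ i ≤ K, walkNormSq x i < ρ
    · have e : walkStays ρ x K = 1 := if_pos hK
      rw [ih1 hK, e, one_mul, add_sub_cancel]
      refine ⟨fun _ ↦ rfl, ?_⟩
      have h1 := walkNormSq_succ_le x hρ hδ (hK K le_rfl)
      have h2 := mul_nonneg hC (Finset.sum_nonneg fun k (_ : k ∈ Finset.range K) ↦ h4 k)
      linarith
    · have e : walkStays ρ x K = 0 := if_neg hK
      rw [e, zero_mul, add_zero]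
      refine ⟨fun h ↦ absurd (fun i hi ↦ h i (hi.trans K.le_succ)) hK, ?_⟩
      have := mul_nonneg hC (h4 K)
      linarith

section Model

variable {n : ℕ}

theorem iIndepFun_gaussianVectorNoise :
    iIndepFun (fun (p : Fin n × ℕ) (x : Fin n → ℕ → ℝ) ↦ x p.1 p.2) (gaussianVectorNoise n) :=
  iIndepFun_uncurry_infinitePi' (X := fun _ _ x ↦ x) (fun _ _ ↦ gaussianReal 0 1)
    fun _ _ ↦ measurable_id

theorem measurePreserving_gaussianVectorNoise (j : Fin n) (l : ℕ) :
    MeasurePreserving (fun x : Fin n → ℕ → ℝ ↦ x j l) (gaussianVectorNoise n)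
      (gaussianReal 0 1) :=
  (measurePreserving_eval_infinitePi (fun _ : ℕ ↦ gaussianReal 0 1) l).comp
    (measurePreserving_eval_infinitePi (fun _ : Fin n ↦ gaussianNoise) j)

theorem measurable_walkSum {m : MeasurableSpace (Fin n → ℕ → ℝ)} {k : ℕ}
    (h : ∀ (j : Fin n), ∀ l < k, Measurable[m] fun x : Fin n → ℕ → ℝ ↦ x j l) (j : Fin n) :
    Measurable[m] fun x : Fin n → ℕ → ℝ ↦ ∑ l ∈ Finset.range k, x j l :=
  Finset.measurable_sum _ fun l hl ↦ h j l (Finset.mem_range.1 hl)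

theorem measurable_walkNormSq {m : MeasurableSpace (Fin n → ℕ → ℝ)} {k : ℕ}
    (h : ∀ (j : Fin n), ∀ l < k, Measurable[m] fun x : Fin n → ℕ → ℝ ↦ x j l) :
    Measurable[m] fun x : Fin n → ℕ → ℝ ↦ walkNormSq x k :=
  Finset.measurable_sum _ fun j _ ↦ (measurable_walkSum h j).pow_const 2

theorem measurable_walkStays (ρ : ℝ) {m : MeasurableSpace (Fin n → ℕ → ℝ)} {k : ℕ}
    (h : ∀ (j : Fin n), ∀ l < k, Measurable[m] fun x : Fin n → ℕ → ℝ ↦ x j l) :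
    Measurable[m] fun x : Fin n → ℕ → ℝ ↦ walkStays ρ x k := by
  classical
  refine Measurable.ite ?_ measurable_const measurable_const
  have : {x : Fin n → ℕ → ℝ | ∀ i ≤ k, walkNormSq x i < ρ}
      = ⋂ i ∈ Finset.Iic k, {x | walkNormSq x i < ρ} := by
    ext; simp
  rw [this]
  exact Finset.measurableSet_biInter _ fun i hi ↦ measurableSet_lt
    (measurable_walkNormSq fun j l hl ↦ h j l (hl.trans_le (Finset.mem_Iic.1 hi)))
    measurable_const

theorem walkStays_nonneg (ρ : ℝ) (x : Fin n → ℕ → ℝ) (k : ℕ) : 0 ≤ walkStays ρ x k := by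
  unfold walkStays; split_ifs <;> simp

theorem walkStays_le_one (ρ : ℝ) (x : Fin n → ℕ → ℝ) (k : ℕ) : walkStays ρ x k ≤ 1 := by
  unfold walkStays; split_ifs <;> simp

theorem memLp_walkSum (j : Fin n) (k : ℕ) :
    MemLp (fun x : Fin n → ℕ → ℝ ↦ ∑ l ∈ Finset.range k, x j l) 2 (gaussianVectorNoise n) := by
  have h : MemLp id 2 (gaussianReal 0 1) := memLp_id_gaussianReal 2
  exact memLp_finsetSum _ fun l _ ↦
    h.comp_measurePreserving (measurePreserving_gaussianVectorNoise j l)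

theorem integrable_walkStays (ρ : ℝ) (k : ℕ) :
    Integrable (fun x : Fin n → ℕ → ℝ ↦ walkStays ρ x k) (gaussianVectorNoise n) := by
  refine (integrable_const 1).mono'
    (measurable_walkStays ρ fun j l _ ↦ by fun_prop).aestronglyMeasurable
    (Filter.Eventually.of_forall fun x ↦ ?_)
  rw [Real.norm_of_nonneg (walkStays_nonneg _ _ _)]
  exact walkStays_le_one _ _ _

theorem integrable_walkStays_mul_walkSum (ρ : ℝ) (j : Fin n) (k : ℕ) :
    Integrable (fun x : Fin n → ℕ → ℝ ↦ walkStays ρ x k * ∑ l ∈ Finset.range k, x j l)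
      (gaussianVectorNoise n) := by
  refine ((memLp_walkSum j k).integrable one_le_two).bdd_mul (c := 1)
    (measurable_walkStays ρ fun j l _ ↦ by fun_prop).aestronglyMeasurable
    (Filter.Eventually.of_forall fun x ↦ ?_)
  rw [Real.norm_of_nonneg (walkStays_nonneg _ _ _)]
  exact walkStays_le_one _ _ _

theorem integral_gaussianVectorNoise (j : Fin n) (k : ℕ) {f : ℝ → ℝ} (hf : Measurable f) :
    ∫ x : Fin n → ℕ → ℝ, f (x j k) ∂gaussianVectorNoise n = ∫ z, f z ∂gaussianReal 0 1 := by
  have h := (measurePreserving_gaussianVectorNoise j k).hasLaw.integral_comp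
    hf.aestronglyMeasurable
  exact h

theorem integrable_pow_gaussianVectorNoise (j : Fin n) (k m : ℕ) :
    Integrable (fun x : Fin n → ℕ → ℝ ↦ x j k ^ m) (gaussianVectorNoise n) := by
  have h : MemLp id m (gaussianReal 0 1) := memLp_id_gaussianReal' _ (by simp)
  rcases Nat.eq_zero_or_pos m with rfl | hm
  · simp
  have h' : Integrable (fun z : ℝ ↦ z ^ m) (gaussianReal 0 1) := by
    refine (integrable_norm_iff (by fun_prop)).1 ?_
    simpa using h.integrable_norm_pow hm.ne'
  exact (measurePreserving_gaussianVectorNoise j k).integrable_comp_of_integrable h'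

theorem integral_sq_gaussianReal_zero_one : ∫ z, z ^ 2 ∂gaussianReal 0 1 = 1 := by
  have h := variance_fun_id_gaussianReal (μ := 0) (v := 1)
  rw [variance_eq_integral (by fun_prop)] at h
  simpa using h

/-- Optional stopping for `|S_k|² - n k`: the indicator depends on steps before `k` only, so the
cross term has mean zero and each coordinate of the new step contributes variance `1`. -/
theorem integral_walkStays_mul_increment (ρ : ℝ) (k : ℕ) :
    Integrable (fun x : Fin n → ℕ → ℝ ↦ walkStays ρ x k
        * (walkNormSq x (k + 1) - walkNormSq x k)) (gaussianVectorNoise n) ∧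
    ∫ x : Fin n → ℕ → ℝ, walkStays ρ x k * (walkNormSq x (k + 1) - walkNormSq x k)
        ∂gaussianVectorNoise n
      = n * ∫ x : Fin n → ℕ → ℝ, walkStays ρ x k ∂gaussianVectorNoise n := by
  have hmeas (j : Fin n) (l) (hl : l < k) :
      Measurable[⨆ p ∈ {p : Fin n × ℕ | p.2 < k}, MeasurableSpace.comap
        (fun x : Fin n → ℕ → ℝ ↦ x p.1 p.2) inferInstance] fun x : Fin n → ℕ → ℝ ↦ x j l :=
    measurable_iSup_comap (fun (p : Fin n × ℕ) (x : Fin n → ℕ → ℝ) ↦ x p.1 p.2)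
      (S := {p : Fin n × ℕ | p.2 < k}) (i := (j, l)) hl
  have hind {f : (Fin n → ℕ → ℝ) → ℝ} (j : Fin n)
      (hf : Measurable[⨆ p ∈ {p : Fin n × ℕ | p.2 < k}, MeasurableSpace.comap
        (fun x : Fin n → ℕ → ℝ ↦ x p.1 p.2) inferInstance] f) :
      IndepFun f (fun x : Fin n → ℕ → ℝ ↦ x j k) (gaussianVectorNoise n) :=
    indepFun_of_measurable_iSup iIndepFun_gaussianVectorNoise (fun p ↦ by fun_prop)
      (S := {p : Fin n × ℕ | p.2 < k}) (i := (j, k)) (by simp) hf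
  have h1 (j : Fin n) := hind j ((measurable_walkStays ρ hmeas).mul (measurable_walkSum hmeas j))
  have h2 (j : Fin n) := (hind j (measurable_walkStays ρ hmeas)).comp measurable_id
    (measurable_id.pow_const 2)
  have hx (j : Fin n) : Integrable (fun x : Fin n → ℕ → ℝ ↦ x j k) (gaussianVectorNoise n) := by
    simpa using integrable_pow_gaussianVectorNoise j k 1
  have hx2 (j : Fin n) := integrable_pow_gaussianVectorNoise j k 2
  have i1 (j : Fin n) : Integrable (fun x : Fin n → ℕ → ℝ ↦ walkStays ρ x k
      * (∑ l ∈ Finset.range k, x j l) * x j k) (gaussianVectorNoise n) :=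
    (h1 j).integrable_mul (integrable_walkStays_mul_walkSum ρ j k) (hx j)
  have i2 (j : Fin n) : Integrable (fun x : Fin n → ℕ → ℝ ↦ walkStays ρ x k * x j k ^ 2)
      (gaussianVectorNoise n) :=
    (h2 j).integrable_mul (integrable_walkStays ρ k) (hx2 j)
  have e1 (j : Fin n) : ∫ x : Fin n → ℕ → ℝ, walkStays ρ x k
      * (∑ l ∈ Finset.range k, x j l) * x j k ∂gaussianVectorNoise n = 0 := by
    have h := (h1 j).integral_fun_mul_eq_mul_integral
      (integrable_walkStays_mul_walkSum ρ j k).aestronglyMeasurable (hx j).aestronglyMeasurable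
    rw [integral_gaussianVectorNoise j k (f := fun z ↦ z) measurable_id,
      integral_id_gaussianReal, mul_zero] at h
    exact h
  have e2 (j : Fin n) : ∫ x : Fin n → ℕ → ℝ, walkStays ρ x k * x j k ^ 2
      ∂gaussianVectorNoise n = ∫ x : Fin n → ℕ → ℝ, walkStays ρ x k ∂gaussianVectorNoise n := by
    have h := (h2 j).integral_fun_mul_eq_mul_integral
      (integrable_walkStays ρ k).aestronglyMeasurable (hx2 j).aestronglyMeasurable
    simp only [Function.comp_def, id] at h
    rwa [integral_gaussianVectorNoise j k (f := fun z ↦ z ^ 2) (measurable_id.pow_const 2),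
      integral_sq_gaussianReal_zero_one, mul_one] at h
  have e (x : Fin n → ℕ → ℝ) : walkStays ρ x k * (walkNormSq x (k + 1) - walkNormSq x k)
      = ∑ j, (2 * (walkStays ρ x k * (∑ l ∈ Finset.range k, x j l) * x j k)
        + walkStays ρ x k * x j k ^ 2) := by
    rw [walkNormSq_succ, Finset.mul_sum]
    exact Finset.sum_congr rfl fun j _ ↦ by ring
  have i3 (j : Fin n) : Integrable (fun x : Fin n → ℕ → ℝ ↦ 2 * (walkStays ρ x k
      * (∑ l ∈ Finset.range k, x j l) * x j k) + walkStays ρ x k * x j k ^ 2)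
      (gaussianVectorNoise n) := ((i1 j).const_mul 2).add (i2 j)
  simp only [e]
  refine ⟨integrable_finsetSum _ fun j _ ↦ i3 j, ?_⟩
  rw [integral_finsetSum _ fun j _ ↦ i3 j]
  have (j : Fin n) : ∫ x : Fin n → ℕ → ℝ, (2 * (walkStays ρ x k
      * (∑ l ∈ Finset.range k, x j l) * x j k) + walkStays ρ x k * x j k ^ 2)
      ∂gaussianVectorNoise n = ∫ x : Fin n → ℕ → ℝ, walkStays ρ x k ∂gaussianVectorNoise n := by
    rw [integral_add ((i1 j).const_mul 2) (i2 j), integral_const_mul, e1, e2]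
    ring
  simp [this]

/-- A bound on the mean time that the Gaussian walk needs to leave a ball. -/
theorem mul_sum_integral_walkStays_le {ρ δ : ℝ} (hρ : 0 < ρ) (hδ : 0 < δ) (K : ℕ) :
    n * ∑ k ∈ Finset.range K, ∫ x : Fin n → ℕ → ℝ, walkStays ρ x k ∂gaussianVectorNoise n
      ≤ (1 + 2 * δ) * ρ + (1 + 1 / δ) ^ 2 / (4 * δ) * (n / ρ)
        * (K * (n * ∫ z, z ^ 4 ∂gaussianReal 0 1)) := by
  have i4 (k : ℕ) (j : Fin n) := integrable_pow_gaussianVectorNoise j k 4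
  have i4s (k : ℕ) : Integrable (fun x : Fin n → ℕ → ℝ ↦ ∑ j, x j k ^ 4)
      (gaussianVectorNoise n) := integrable_finsetSum _ fun j _ ↦ i4 k j
  have i4' : Integrable (fun x : Fin n → ℕ → ℝ ↦ ∑ k ∈ Finset.range K, ∑ j, x j k ^ 4)
      (gaussianVectorNoise n) := integrable_finsetSum _ fun k _ ↦ i4s k
  have e4 (k : ℕ) (j : Fin n) : ∫ x : Fin n → ℕ → ℝ, x j k ^ 4 ∂gaussianVectorNoise n
      = ∫ z, z ^ 4 ∂gaussianReal 0 1 :=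
    integral_gaussianVectorNoise j k (f := fun z ↦ z ^ 4) (by fun_prop)
  have e4' : ∫ x : Fin n → ℕ → ℝ, ∑ k ∈ Finset.range K, ∑ j, x j k ^ 4 ∂gaussianVectorNoise n
      = K * (n * ∫ z, z ^ 4 ∂gaussianReal 0 1) := by
    rw [integral_finsetSum _ fun k _ ↦ i4s k]
    simp only [fun k ↦ integral_finsetSum Finset.univ fun j _ ↦ i4 k j, e4]
    simp
  have h := integral_mono (μ := gaussianVectorNoise n)
    (integrable_finsetSum (Finset.range K) fun k _ ↦
      (integral_walkStays_mul_increment (n := n) ρ k).1)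
    ((integrable_const ((1 + 2 * δ) * ρ)).add
      (i4'.const_mul ((1 + 1 / δ) ^ 2 / (4 * δ) * (n / ρ))))
    fun x ↦ sum_walkStays_mul_le x hρ hδ K
  rw [integral_finsetSum _ fun k _ ↦ (integral_walkStays_mul_increment ρ k).1] at h
  simp only [(integral_walkStays_mul_increment ρ _).2] at h
  rw [← Finset.mul_sum] at h
  refine h.trans (le_of_eq ?_)
  refine (integral_add (integrable_const _) (i4'.const_mul _)).trans ?_
  rw [integral_const, integral_const_mul, e4']
  simp

end Model

-- Lower bound: scaling and convexity

open Classical in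
-- With `d = D / √n`, the count is at least `L / d²` unless truncated, so this is the tangent-line
-- bound `3/2 - 1/(2d²) ≤ d` at `d = 1`. Truncation at `3L` is harmless: there the left side is `0`.
theorem sqrt_mul_le_of_count {n L : ℕ} (hn : 1 ≤ n) (hL : 1 ≤ L) {D : ℝ} (hD : 0 ≤ D) :
    √n * (3 / 2 - (∑ k ∈ Finset.range (3 * L), if k * D ^ 2 < n * L then (1 : ℝ) else 0)
      / (2 * L)) ≤ D := by
  have hn0 : (0 : ℝ) < n := by exact_mod_cast hn
  have hL0 : (0 : ℝ) < L := by exact_mod_cast hL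
  have hs : 0 < √(n : ℝ) := Real.sqrt_pos.2 hn0
  have hsq : √(n : ℝ) ^ 2 = n := Real.sq_sqrt hn0.le
  rw [Finset.sum_boole]
  set A := Finset.filter (fun k : ℕ ↦ (k : ℝ) * D ^ 2 < n * L) (Finset.range (3 * L)) with hA
  have hle : A.card ≤ 3 * L := by simpa using Finset.card_filter_le (Finset.range (3 * L)) _
  rcases hle.eq_or_lt with h | h
  · rw [h]
    have : (3 / 2 - ((3 * L : ℕ) : ℝ) / (2 * L)) = 0 := by push_cast; field_simp; ring
    rw [this, mul_zero]
    exact hD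
  have hexit : (n : ℝ) * L ≤ A.card * D ^ 2 := by
    by_contra! hlt
    -- The counted set is an initial segment, so if its cardinality satisfied the condition it would
    -- contain one element too many.
    have hsub : Finset.range (A.card + 1) ⊆ A := by
      intro k hk
      have hk' : k ≤ A.card := Nat.lt_succ_iff.1 (Finset.mem_range.1 hk)
      refine Finset.mem_filter.2 ⟨Finset.mem_range.2 (hk'.trans_lt h), lt_of_le_of_lt ?_ hlt⟩
      have : (k : ℝ) ≤ A.card := by exact_mod_cast hk'
      gcongr
    have := Finset.card_le_card hsub
    rw [Finset.card_range] at this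
    omega
  obtain ⟨d, hd⟩ : ∃ d, d = D / √(n : ℝ) := ⟨_, rfl⟩
  have hDd : D = √(n : ℝ) * d := by
    rw [mul_comm]; exact ((eq_div_iff hs.ne').1 hd).symm
  have hd0 : 0 ≤ d := by rw [hd]; positivity
  obtain ⟨t, ht⟩ : ∃ t, t = (A.card : ℝ) / L := ⟨_, rfl⟩
  have hAt : (A.card : ℝ) = L * t := by
    rw [mul_comm]; exact ((eq_div_iff hL0.ne').1 ht).symm
  have hdt : 1 ≤ t * d ^ 2 := by
    rw [hDd, mul_pow, hsq, hAt] at hexit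
    have : (n * L : ℝ) * 1 ≤ (n * L) * (t * d ^ 2) := by linarith
    exact le_of_mul_le_mul_left this (by positivity)
  have e : (A.card : ℝ) / (2 * L) = t / 2 := by rw [hAt]; field_simp
  rw [e, hDd]
  refine mul_le_mul_of_nonneg_left ?_ hs.le
  by_contra! hlt
  have h1 : t * d ^ 2 ≤ (3 - 2 * d) * d ^ 2 :=
    mul_le_mul_of_nonneg_right (by linarith) (sq_nonneg d)
  -- This product is `2d³ - 3d² + 1`, the tangent-line bound cleared of denominators.
  have h2 : 0 ≤ (d - 1) ^ 2 * (2 * d + 1) := by positivity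
  have hd1 : (d - 1) ^ 2 * (2 * d + 1) = 0 := by nlinarith
  have hd1' : d = 1 := by
    rcases mul_eq_zero.1 hd1 with h | h
    · nlinarith
    · linarith
  rw [hd1'] at hdt hlt
  linarith

section BrownianMotion

variable {Ω : Type*} [MeasurableSpace Ω] {P : Measure Ω} {n : ℕ}
  {W : ℝ≥0 → Ω → EuclideanSpace ℝ (Fin n)}

theorem sum_grid_increments (B : ℝ≥0 → ℝ) (c : ℝ≥0) (i : ℕ) :
    ∑ l ∈ Finset.range i, (B (c * (l + 1)) - B (c * l)) = B (c * i) - B 0 := by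
  have := Finset.sum_range_sub (fun l : ℕ ↦ B (c * l)) i
  simpa using this

theorem IsBrownianMotion.ae_zero_eq_zero (hW : IsBrownianMotion W P) :
    ∀ᵐ ω ∂P, ∀ j, W 0 ω j = 0 :=
  ae_all_iff.2 fun j ↦ (hW.isBrownianReal_coord j).eval_zero_ae_eq_zero

theorem IsBrownianMotion.ae_continuous (hW : IsBrownianMotion W P) :
    ∀ᵐ ω ∂P, Continuous fun t ↦ W t ω := by
  filter_upwards [ae_all_iff.2 fun j ↦ (hW.isBrownianReal_coord j).cont] with ω h
  exact (PiLp.continuous_toLp 2 _).comp (continuous_pi h)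

theorem measurable_stays_indicator (k ρ : ℝ) [DecidablePred fun z : ℝ ↦ k * z ^ 2 < ρ] :
    Measurable fun z : ℝ ↦ if k * z ^ 2 < ρ then (1 : ℝ) else 0 :=
  Measurable.ite (measurableSet_lt (by fun_prop) measurable_const) measurable_const
    measurable_const

open Classical in
theorem integrable_stays_indicator [IsProbabilityMeasure P] {D : Ω → ℝ} (hD : AEMeasurable D P)
    (k ρ : ℝ) : Integrable (fun ω ↦ if k * D ω ^ 2 < ρ then (1 : ℝ) else 0) P := by
  refine (integrable_const 1).mono'
    ((measurable_stays_indicator k ρ).comp_aemeasurable hD).aestronglyMeasurable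
    (Filter.Eventually.of_forall fun ω ↦ ?_)
  split_ifs <;> simp

open Classical in
/-- If `D` dominates the norm of Brownian motion up to time `1`, then by scaling `√k D` is less
likely than the Gaussian walk with `k` steps to stay below a given level. -/
theorem IsBrownianMotion.integral_stays_indicator_le [IsProbabilityMeasure P]
    (hW : IsBrownianMotion W P) {D : Ω → ℝ} (hD : AEMeasurable D P)
    (hdom : ∀ᵐ ω ∂P, ∀ s ≤ 1, ∑ j, W s ω j ^ 2 ≤ D ω ^ 2) {ρ : ℝ} (hρ : 0 < ρ) (k : ℕ) :
    ∫ ω, (if k * D ω ^ 2 < ρ then (1 : ℝ) else 0) ∂P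
      ≤ ∫ x, walkStays ρ x k ∂gaussianVectorNoise n := by
  rcases Nat.eq_zero_or_pos k with rfl | hk
  · have e (x : Fin n → ℕ → ℝ) : walkStays ρ x 0 = 1 :=
      if_pos fun i hi ↦ by simpa [Nat.le_zero.1 hi, walkNormSq] using hρ
    simp [e, hρ]
  have hk0 : (0 : ℝ) < k := by exact_mod_cast hk
  -- With mesh `1/k`, normalizing increments multiplies the path by `√k`, and `k` steps fill the
  -- time interval `[0, 1]`.
  set c : ℝ≥0 := (k : ℝ≥0)⁻¹ with hc
  have hc0 : c ≠ 0 := by rw [hc]; exact inv_ne_zero (by exact_mod_cast hk.ne')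
  have hcr : (c : ℝ) = (k : ℝ)⁻¹ := by simp [hc]
  have hsq : ((√(c : ℝ))⁻¹) ^ 2 = k := by
    rw [inv_pow, Real.sq_sqrt c.coe_nonneg, hcr, inv_inv]
  have hlaw := hW.hasLaw_increments hc0
  have hm : Measurable fun x : Fin n → ℕ → ℝ ↦ walkStays ρ x k :=
    measurable_walkStays ρ fun j l _ ↦ by fun_prop
  rw [← hlaw.integral_comp hm.aestronglyMeasurable]
  have hint : Integrable (fun ω ↦ walkStays ρ (fun (j : Fin n) (l : ℕ) ↦
      (√c)⁻¹ * (W (c * (l + 1)) ω j - W (c * l) ω j)) k) P := by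
    refine (integrable_const 1).mono'
      (hm.comp_aemeasurable hlaw.aemeasurable).aestronglyMeasurable
      (Filter.Eventually.of_forall fun x ↦ ?_)
    rw [Real.norm_of_nonneg (walkStays_nonneg _ _ _)]
    exact walkStays_le_one _ _ _
  refine integral_mono_ae (integrable_stays_indicator hD k ρ) hint ?_
  filter_upwards [hdom, hW.ae_zero_eq_zero] with ω hω h0
  split_ifs with h
  · refine le_of_eq (if_pos fun i hi ↦ ?_).symm
    have e : walkNormSq (fun (j : Fin n) (l : ℕ) ↦
        (√c)⁻¹ * (W (c * (l + 1)) ω j - W (c * l) ω j)) i = k * ∑ j, W (c * i) ω j ^ 2 := by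
      rw [walkNormSq, Finset.mul_sum]
      refine Finset.sum_congr rfl fun j _ ↦ ?_
      rw [← Finset.mul_sum, sum_grid_increments (fun t ↦ W t ω j), h0 j, sub_zero, mul_pow, hsq]
    have hci : c * i ≤ 1 := by
      rw [hc, inv_mul_le_iff₀ (by exact_mod_cast hk), mul_one]
      exact_mod_cast hi
    rw [e]
    exact (mul_le_mul_of_nonneg_left (hω _ hci) hk0.le).trans_lt h
  · exact walkStays_nonneg _ _ _

/-- Summing the comparison of indicators over `k < 3L` bounds the mean count by the mean exit time
of the walk, about `L`; the tangent-line bound then gives `√n (3/2 - 1/2)` as `L → ∞` and `δ → 0`.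
-/
theorem IsBrownianMotion.sqrt_le_integral_of_dominates [IsProbabilityMeasure P] (hn : 1 ≤ n)
    (hW : IsBrownianMotion W P) {D : Ω → ℝ} (hD : Integrable D P) (hD0 : ∀ ω, 0 ≤ D ω)
    (hdom : ∀ᵐ ω ∂P, ∀ s ≤ 1, ∑ j, W s ω j ^ 2 ≤ D ω ^ 2) :
    √n ≤ ∫ ω, D ω ∂P := by
  classical
  have hn0 : (0 : ℝ) < n := by exact_mod_cast hn
  set M := ∫ z, z ^ 4 ∂gaussianReal 0 1 with hM
  have key (δ : ℝ) (hδ : 0 < δ) (L : ℕ) (hL : 1 ≤ L) :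
      √n * (1 - δ - (1 + 1 / δ) ^ 2 / (4 * δ) * (3 * M) / 2 * (L : ℝ)⁻¹) ≤ ∫ ω, D ω ∂P := by
    have hL0 : (0 : ℝ) < L := by exact_mod_cast hL
    have hρ : (0 : ℝ) < n * L := by positivity
    have hI (k : ℕ) : Integrable (fun ω ↦ if k * D ω ^ 2 < n * L then (1 : ℝ) else 0) P :=
      integrable_stays_indicator hD.aemeasurable k (n * L)
    have h1 : ∑ k ∈ Finset.range (3 * L), ∫ ω, (if k * D ω ^ 2 < n * L then (1 : ℝ) else 0) ∂P
        ≤ (1 + 2 * δ) * L + (1 + 1 / δ) ^ 2 / (4 * δ) * (3 * M) := by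
      refine (Finset.sum_le_sum fun k _ ↦
        hW.integral_stays_indicator_le hD.aemeasurable hdom hρ k).trans ?_
      -- For `ρ = n * L` and `3L` steps, `L` cancels from the overshoot term, which is therefore
      -- negligible against `L`.
      have h := mul_sum_integral_walkStays_le (n := n) hρ hδ (3 * L)
      refine le_of_mul_le_mul_left (h.trans (le_of_eq ?_)) hn0
      push_cast
      rw [← hM]
      generalize (1 + 1 / δ) ^ 2 / (4 * δ) = C
      field_simp
    have hS : Integrable (fun ω ↦ ∑ k ∈ Finset.range (3 * L),
        if k * D ω ^ 2 < n * L then (1 : ℝ) else 0) P := integrable_finsetSum _ fun k _ ↦ hI k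
    have h2 := integral_mono (((integrable_const (3 / 2)).sub (hS.div_const (2 * L))).const_mul
      √(n : ℝ)) hD fun ω ↦ sqrt_mul_le_of_count hn hL (hD0 ω)
    have h3 : ∫ ω, √(n : ℝ) * (3 / 2 - (∑ k ∈ Finset.range (3 * L),
        if k * D ω ^ 2 < n * L then (1 : ℝ) else 0) / (2 * L)) ∂P
        = √n * (3 / 2 - (∑ k ∈ Finset.range (3 * L),
          ∫ ω, (if k * D ω ^ 2 < n * L then (1 : ℝ) else 0) ∂P) / (2 * L)) := by
      rw [integral_const_mul, integral_sub (integrable_const _) (hS.div_const _), integral_const,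
        integral_div, integral_finsetSum _ fun k _ ↦ hI k]
      simp
    refine le_trans ?_ (h3.symm.trans_le h2)
    refine mul_le_mul_of_nonneg_left ?_ (Real.sqrt_nonneg _)
    have h4 := div_le_div_of_nonneg_right h1 (show (0 : ℝ) ≤ 2 * L by positivity)
    have h5 : ((1 + 2 * δ) * L + (1 + 1 / δ) ^ 2 / (4 * δ) * (3 * M)) / (2 * L)
        = 1 / 2 + δ + (1 + 1 / δ) ^ 2 / (4 * δ) * (3 * M) / 2 * (L : ℝ)⁻¹ := by
      generalize (1 + 1 / δ) ^ 2 / (4 * δ) = C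
      field_simp
    linarith
  have key2 (δ : ℝ) (hδ : 0 < δ) : √n * (1 - δ) ≤ ∫ ω, D ω ∂P := by
    have hlim : Filter.Tendsto (fun L : ℕ ↦ √(n : ℝ) * (1 - δ
        - (1 + 1 / δ) ^ 2 / (4 * δ) * (3 * M) / 2 * (L : ℝ)⁻¹)) Filter.atTop
        (nhds (√n * (1 - δ - (1 + 1 / δ) ^ 2 / (4 * δ) * (3 * M) / 2 * 0))) :=
      ((tendsto_inv_atTop_nhds_zero_nat.const_mul _).const_sub _).const_mul _
    rw [mul_zero, sub_zero] at hlim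
    refine le_of_tendsto hlim ?_
    filter_upwards [Filter.eventually_ge_atTop 1] with L hL using key δ hδ L hL
  have hlim : Filter.Tendsto (fun δ : ℝ ↦ √(n : ℝ) * (1 - δ)) (nhdsWithin 0 (Set.Ioi 0))
      (nhds (√n * (1 - 0))) :=
    ((continuous_const.mul (continuous_const.sub continuous_id)).tendsto 0).mono_left
      nhdsWithin_le_nhds
  rw [sub_zero, mul_one] at hlim
  refine le_of_tendsto hlim ?_
  filter_upwards [self_mem_nhdsWithin] with δ hδ using key2 δ hδ

end BrownianMotion

-- The diameter: measurability and second moment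

section HullDiameter

variable {Ω : Type*} {n : ℕ} {W : ℝ≥0 → Ω → EuclideanSpace ℝ (Fin n)}

theorem hullDiam_eq_diam_path (W : ℝ≥0 → Ω → EuclideanSpace ℝ (Fin n)) (t : ℝ≥0) (ω : Ω) :
    hullDiam W t ω = Metric.diam ((fun s ↦ W s ω) '' Set.Icc 0 t) :=
  convexHull_diam _

theorem dist_le_hullDiam {ω : Ω} (hc : Continuous fun t ↦ W t ω) {s t u : ℝ≥0} (hs : s ≤ u)
    (ht : t ≤ u) : dist (W s ω) (W t ω) ≤ hullDiam W u ω := by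
  rw [hullDiam_eq_diam_path]
  exact Metric.dist_le_diam_of_mem (isCompact_Icc.image hc).isBounded
    ⟨s, ⟨zero_le, hs⟩, rfl⟩ ⟨t, ⟨zero_le, ht⟩, rfl⟩

theorem exists_hullDiam_eq_dist {ω : Ω} (hc : Continuous fun t ↦ W t ω) (u : ℝ≥0) :
    ∃ s ≤ u, ∃ t ≤ u, hullDiam W u ω = dist (W s ω) (W t ω) := by
  have hcont : Continuous fun p : ℝ≥0 × ℝ≥0 ↦ dist (W p.1 ω) (W p.2 ω) :=
    (hc.comp continuous_fst).dist (hc.comp continuous_snd)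
  have hne : (Set.Icc (0 : ℝ≥0) u ×ˢ Set.Icc (0 : ℝ≥0) u).Nonempty :=
    (Set.nonempty_Icc.2 zero_le).prod (Set.nonempty_Icc.2 zero_le)
  obtain ⟨p, hp, hmax⟩ := (isCompact_Icc.prod isCompact_Icc).exists_isMaxOn hne hcont.continuousOn
  have hp' := Set.mem_prod.1 hp
  refine ⟨p.1, hp'.1.2, p.2, hp'.2.2, le_antisymm ?_ (dist_le_hullDiam hc hp'.1.2 hp'.2.2)⟩
  rw [hullDiam_eq_diam_path]
  refine Metric.diam_le_of_forall_dist_le dist_nonneg ?_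
  rintro _ ⟨a, ha, rfl⟩ _ ⟨b, hb, rfl⟩
  exact isMaxOn_iff.1 hmax (a, b) (Set.mk_mem_prod ha hb)

/-- By compactness the diameter is attained at two times; rounding them down to the grid suffices by
continuity. -/
theorem exists_grid_tendsto_hullDiam {ω : Ω} (hc : Continuous fun t ↦ W t ω) :
    ∃ i j : ℕ → ℕ, (∀ N, i N ≤ N + 1) ∧ (∀ N, j N ≤ N + 1) ∧
      Filter.Tendsto (fun N : ℕ ↦ dist (W ((N + 1 : ℝ≥0)⁻¹ * i N) ω)
        (W ((N + 1 : ℝ≥0)⁻¹ * j N) ω)) Filter.atTop (nhds (hullDiam W 1 ω)) := by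
  obtain ⟨s, hs, t, ht, h⟩ := exists_hullDiam_eq_dist hc 1
  have hfloor {s : ℝ≥0} (hs : s ≤ 1) (N : ℕ) : ⌊s * (N + 1)⌋₊ ≤ N + 1 := by
    refine Nat.floor_le_of_le ?_
    push_cast
    exact mul_le_of_le_one_left zero_le hs
  have hlim (s : ℝ≥0) : Filter.Tendsto (fun N : ℕ ↦ (N + 1 : ℝ≥0)⁻¹ * ⌊s * (N + 1)⌋₊)
      Filter.atTop (nhds s) := by
    have h1 : Filter.Tendsto (fun N : ℕ ↦ ((N + 1 : ℕ) : ℝ)) Filter.atTop Filter.atTop :=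
      tendsto_natCast_atTop_atTop.comp (Filter.tendsto_add_atTop_nat 1)
    have h2 := (tendsto_nat_floor_mul_div_atTop (R := ℝ) (a := s) s.coe_nonneg).comp h1
    rw [← NNReal.tendsto_coe]
    refine h2.congr fun N ↦ ?_
    simp only [Function.comp_apply, Nat.cast_add, Nat.cast_one]
    rw [div_eq_inv_mul]
    push_cast
    rfl
  refine ⟨fun N ↦ ⌊s * (N + 1)⌋₊, fun N ↦ ⌊t * (N + 1)⌋₊, hfloor hs, hfloor ht, ?_⟩
  rw [h]
  exact ((hc.tendsto s).comp (hlim s)).dist ((hc.tendsto t).comp (hlim t))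

/-- The sum over the coordinates of the squared range over the grid of mesh `1 / (N + 1)`. -/
noncomputable def gridRangeSq (W : ℝ≥0 → Ω → EuclideanSpace ℝ (Fin n)) (N : ℕ) (ω : Ω) : ℝ :=
  ∑ j, walkRange (fun l ↦ W ((N + 1 : ℝ≥0)⁻¹ * (l + 1)) ω j - W ((N + 1 : ℝ≥0)⁻¹ * l) ω j)
    (N + 1) ^ 2

theorem dist_sq_le_gridRangeSq (W : ℝ≥0 → Ω → EuclideanSpace ℝ (Fin n)) {N i k : ℕ}
    (hi : i ≤ N + 1) (hk : k ≤ N + 1) (ω : Ω) :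
    dist (W ((N + 1 : ℝ≥0)⁻¹ * i) ω) (W ((N + 1 : ℝ≥0)⁻¹ * k) ω) ^ 2 ≤ gridRangeSq W N ω := by
  rw [EuclideanSpace.dist_eq, Real.sq_sqrt (Finset.sum_nonneg fun j _ ↦ sq_nonneg _), gridRangeSq]
  refine Finset.sum_le_sum fun j _ ↦ pow_le_pow_left₀ dist_nonneg ?_ 2
  have h1 := sum_sub_sum_le_walkRange (fun l ↦ W ((N + 1 : ℝ≥0)⁻¹ * (l + 1)) ω j
    - W ((N + 1 : ℝ≥0)⁻¹ * l) ω j) hi hk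
  have h2 := sum_sub_sum_le_walkRange (fun l ↦ W ((N + 1 : ℝ≥0)⁻¹ * (l + 1)) ω j
    - W ((N + 1 : ℝ≥0)⁻¹ * l) ω j) hk hi
  rw [sum_grid_increments (fun t ↦ W t ω j), sum_grid_increments (fun t ↦ W t ω j)] at h1 h2
  rw [Real.dist_eq, abs_le]
  constructor <;> linarith

variable [MeasurableSpace Ω] {P : Measure Ω}

theorem IsBrownianMotion.aemeasurable (hW : IsBrownianMotion W P) (t : ℝ≥0) :
    AEMeasurable (W t) P :=
  (PiLp.continuous_toLp 2 fun _ : Fin n ↦ ℝ).measurable.comp_aemeasurable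
    (aemeasurable_pi_iff.2 fun j ↦ (hW.isBrownianReal_coord j).aemeasurable t)

theorem IsBrownianMotion.aemeasurable_hullDiam (hW : IsBrownianMotion W P) :
    AEMeasurable (hullDiam W 1) P := by
  -- A countable supremum over grid points represents the diameter almost surely; `min _ 1` keeps
  -- the times in `[0, 1]` for all index triples.
  have hm : AEMeasurable (fun ω ↦ ⨆ p : ℕ × ℕ × ℕ,
      edist (W (min ((p.1 + 1 : ℝ≥0)⁻¹ * p.2.1) 1) ω)
        (W (min ((p.1 + 1 : ℝ≥0)⁻¹ * p.2.2) 1) ω)) P :=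
    AEMeasurable.iSup fun p ↦ (hW.aemeasurable _).edist (hW.aemeasurable _)
  refine hm.ennreal_toReal.congr ?_
  filter_upwards [hW.ae_continuous] with ω hc
  obtain ⟨i, j, hi, hj, hlim⟩ := exists_grid_tendsto_hullDiam hc
  have hgrid {N i : ℕ} (hi : i ≤ N + 1) : (N + 1 : ℝ≥0)⁻¹ * i ≤ 1 := by
    rw [inv_mul_le_iff₀ (by positivity), mul_one]
    exact_mod_cast hi
  have hD : 0 ≤ hullDiam W 1 ω := Metric.diam_nonneg
  rw [← ENNReal.toReal_ofReal hD]
  congr 1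
  refine le_antisymm (iSup_le fun p ↦ ?_) ?_
  · rw [edist_dist]
    exact ENNReal.ofReal_le_ofReal (dist_le_hullDiam hc (min_le_right _ _) (min_le_right _ _))
  · refine le_of_tendsto' (ENNReal.tendsto_ofReal hlim) fun N ↦ ?_
    refine le_trans (le_of_eq ?_) (le_iSup _ (N, i N, j N))
    simp only [min_eq_left (hgrid (hi N)), min_eq_left (hgrid (hj N)), edist_dist]

theorem IsBrownianMotion.integral_gridRangeSq_le (hW : IsBrownianMotion W P) (N : ℕ) :
    Integrable (gridRangeSq W N) P ∧ ∫ ω, gridRangeSq W N ω ∂P ≤ n * (4 * Real.log 2) := by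
  have hI (j : Fin n) := ((hW.isBrownianReal_coord j).memLp_walkRange_increments
    (N + 1 : ℝ≥0)⁻¹ (N + 1)).integrable_sq
  refine ⟨integrable_finsetSum _ fun j _ ↦ hI j, ?_⟩
  unfold gridRangeSq
  rw [integral_finsetSum _ fun j _ ↦ hI j]
  have hle (j : Fin n) := (hW.isBrownianReal_coord j).integral_walkRange_increments_le
    (c := (N + 1 : ℝ≥0)⁻¹) (by positivity) N.succ_pos
  refine (Finset.sum_le_sum fun j _ ↦ hle j).trans (le_of_eq ?_)
  have h0 : (N + 1 : ℝ) ≠ 0 := by positivity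
  simp [h0]

/-- Fatou's lemma along the grids: the squared diameter is a limit of squared grid distances, each
at most the sum of squared coordinate ranges. -/
theorem IsBrownianMotion.memLp_hullDiam [IsProbabilityMeasure P] (hW : IsBrownianMotion W P) :
    MemLp (hullDiam W 1) 2 P ∧ ∫ ω, hullDiam W 1 ω ^ 2 ∂P ≤ n * (4 * Real.log 2) := by
  have hC : 0 ≤ n * (4 * Real.log 2) := by have := Real.log_nonneg one_le_two; positivity
  have hnn (N : ℕ) (ω : Ω) : 0 ≤ gridRangeSq W N ω := Finset.sum_nonneg fun j _ ↦ sq_nonneg _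
  have hm := hW.aemeasurable_hullDiam
  have hle : ∫⁻ ω, ENNReal.ofReal (hullDiam W 1 ω ^ 2) ∂P
      ≤ ENNReal.ofReal (n * (4 * Real.log 2)) := by
    calc _ ≤ ∫⁻ ω, Filter.liminf (fun N ↦ ENNReal.ofReal (gridRangeSq W N ω)) Filter.atTop ∂P := by
          refine lintegral_mono_ae ?_
          filter_upwards [hW.ae_continuous] with ω hc
          obtain ⟨i, j, hi, hj, hlim⟩ := exists_grid_tendsto_hullDiam hc
          rw [← (ENNReal.tendsto_ofReal (hlim.pow 2)).liminf_eq]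
          exact Filter.liminf_le_liminf (Filter.Eventually.of_forall fun N ↦
            ENNReal.ofReal_le_ofReal (dist_sq_le_gridRangeSq W (hi N) (hj N) ω))
      _ ≤ Filter.liminf (fun N ↦ ∫⁻ ω, ENNReal.ofReal (gridRangeSq W N ω) ∂P) Filter.atTop :=
          lintegral_liminf_le' fun N ↦
            (hW.integral_gridRangeSq_le N).1.aemeasurable.ennreal_ofReal
      _ ≤ Filter.liminf (fun _ : ℕ ↦ ENNReal.ofReal (n * (4 * Real.log 2))) Filter.atTop := by
          refine Filter.liminf_le_liminf (Filter.Eventually.of_forall fun N ↦ ?_)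
          rw [← ofReal_integral_eq_lintegral_ofReal (hW.integral_gridRangeSq_le N).1
            (Filter.Eventually.of_forall (hnn N))]
          exact ENNReal.ofReal_le_ofReal (hW.integral_gridRangeSq_le N).2
      _ = _ := Filter.liminf_const _
  have hint : Integrable (fun ω ↦ hullDiam W 1 ω ^ 2) P := by
    refine ⟨(hm.pow_const 2).aestronglyMeasurable, ?_⟩
    rw [hasFiniteIntegral_iff_ofReal (Filter.Eventually.of_forall fun ω ↦ sq_nonneg _)]
    exact hle.trans_lt ENNReal.ofReal_lt_top
  refine ⟨(memLp_two_iff_integrable_sq hm.aestronglyMeasurable).2 hint, ?_⟩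
  rw [← ofReal_integral_eq_lintegral_ofReal hint
    (Filter.Eventually.of_forall fun ω ↦ sq_nonneg _)] at hle
  exact (ENNReal.ofReal_le_ofReal_iff hC).1 hle

theorem IsBrownianMotion.ae_sum_sq_le_hullDiam_sq (hW : IsBrownianMotion W P) :
    ∀ᵐ ω ∂P, ∀ s ≤ 1, ∑ j, W s ω j ^ 2 ≤ hullDiam W 1 ω ^ 2 := by
  filter_upwards [hW.ae_continuous, hW.ae_zero_eq_zero] with ω hc h0 s hs
  have h := pow_le_pow_left₀ dist_nonneg (dist_le_hullDiam hc hs (zero_le (a := (1 : ℝ≥0)))) 2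
  rw [EuclideanSpace.dist_eq, Real.sq_sqrt (Finset.sum_nonneg fun j _ ↦ sq_nonneg _)] at h
  simpa [h0, Real.dist_eq] using h

end HullDiameter

theorem theorem3 {Ω : Type*} [MeasurableSpace Ω] (P : Measure Ω) [IsProbabilityMeasure P]
    (n : ℕ) (hn : 1 ≤ n) (W : ℝ≥0 → Ω → EuclideanSpace ℝ (Fin n)) (hW : IsBrownianMotion W P) :
    Integrable (fun ω ↦ hullDiam W 1 ω) P ∧
      Real.sqrt n ≤ ∫ ω, hullDiam W 1 ω ∂P ∧
      ∫ ω, hullDiam W 1 ω ∂P ≤ 2 * Real.sqrt (Real.log 2) * Real.sqrt n := by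
  obtain ⟨hL2, hsq⟩ := hW.memLp_hullDiam
  have hint : Integrable (hullDiam W 1) P := hL2.integrable one_le_two
  refine ⟨hint, hW.sqrt_le_integral_of_dominates hn hint (fun ω ↦ Metric.diam_nonneg)
    hW.ae_sum_sq_le_hullDiam_sq, ?_⟩
  -- Nonnegative variance is `(E D)² ≤ E D²`, which converts the second moment bound.
  have hvar := variance_nonneg (hullDiam W 1) P
  rw [variance_eq_sub hL2] at hvar
  refine le_of_sq_le_sq ?_ (by positivity)
  have hlog : 0 ≤ Real.log 2 := Real.log_nonneg one_le_two
  rw [mul_pow, mul_pow, Real.sq_sqrt hlog, Real.sq_sqrt n.cast_nonneg]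
  simp only [Pi.pow_apply] at hvar
  linarith
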